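/- Let $s\ge 2$ and $t$ be coprime natural numbers, let $u=\lfloor s/2\rfloor$ and $c=\tfrac12(s-1)(t-1)$. \emph{Groups.} Let $W_s$ be the affine symmetric group, i.e. the group of permutations $w$ of $\mathbb Z$ with $w(m+s)=w(m)+s$ for all $m$ and $w(0)+\dots+w(s-1)=\binom s2$. For $i\in\mathbb Z/s\mathbb Z$ (regarded as a subset of $\mathbb Z$) let $w_i\in W_s$ be given by $w_i(m)=m+1$ if $m\in i-1$, $w_i(m)=m-1$ if $m\in i$, and $w_i(m)=m$ otherwise; these elements generate $W_s$. Let $v_i=w_i$ if $i=0$, $v_i=w_iw_{-i}w_i$ if $i=\pm u$, and $v_i=w_iw_{-i}$ otherwise, and let $H_s\le W_s$ be the subgroup generated by all $v_i$ (the affine hyperoctahedral group of degree $u$). The level $t$ action $w\mapsto\bar w$ of $W_s$ (and of $H_s$) on $\mathbb Z$ is the action with $\bar w_i(m)=m+t$ if $m\in(i-1)t-c$, $\bar w_i(m)=m-t$ if $m\in it-c$, and $\bar w_i(m)=m$ otherwise. \emph{Cores.} The beta-set of a partition $\lambda$ is $\mathcal B(\lambda)=\{\lambda_i-i: i\ge1\}$.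 An $s$-core is a partition none of whose hook lengths equals $s$; let $\mathcal D_s$ be the set of $s$-cores that equal their conjugate. The $s$-set $\mathcal S(\lambda)$ of an $s$-core $\lambda$ consists, for each class $i\in\mathbb Z/s\mathbb Z$, of the smallest integer in $i$ not lying in $\mathcal B(\lambda)$. The group $H_s$ acts on $\mathcal D_s$ (the level $t$ action) by $\mathcal B(\check w\lambda)=\bar w\,\mathcal B(\lambda)$; let $\operatorname{StabSC}_{s,t}(\lambda)$ be the stabiliser of $\lambda\in\mathcal D_s$ under this action. For $N\ge1$ let $\mathcal D_s^{(N)}$ be the set of $\lambda\in\mathcal D_s$ with $k-l<Ns$ for all $k,l\in\mathcal S(\lambda)$, and for $s$-cores $\lambda,\mu$ write $\lambda\equiv_N\mu$ if there is a bijection $\phi:\mathcal S(\lambda)\to\mathcal S(\mu)$ with $\phi(k)\equiv k\pmod{Ns}$ for all $k$. The level $t$ action of $H_s$ on $\mathcal D_s^{(N)}$ sends $\lambda$ under $w$ to the unique $\hat w\lambda\in\mathcal D_s^{(N)}$ with $\hat w\lambda\equiv_N\check w\lambda$. \emph{Statement.} Let $n\ge1$ and $\lambda\in\mathcal D_s^{(nt)}$.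 Then $\operatorname{StabSC}_{s,t}(\lambda)$ is finite, and the orbit containing $\lambda$ under the level $t$ action of $H_s$ on $\mathcal D_s^{(nt)}$ is finite of size $$\frac{(2n)^u\,u!}{|\operatorname{StabSC}_{s,t}(\lambda)|}.$$ -/

import Mathlib

namespace SCCore

/-! ### Partitions, hooks, beta-sets -/

/-- The beta-set `{λ_i - i : i ≥ 1}` of a partition (rows are indexed from `0` here). -/
def betaSet (lam : YoungDiagram) : Set ℤ :=
  Set.range fun i : ℕ => (lam.rowLen i : ℤ) - (i + 1)

/-- The hook length `1 + (λ_r - r) + (λ'_c - c)` of the cell `(r, c)`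
(the cell is indexed from `0`, hence the shift). -/
def hookLength (lam : YoungDiagram) (r c : ℕ) : ℤ :=
  1 + ((lam.rowLen r : ℤ) - (r + 1)) + ((lam.colLen c : ℤ) - (c + 1))

/-- `λ` is an `s`-core: no hook length equals `s`. -/
def IsCore (s : ℕ) (lam : YoungDiagram) : Prop :=
  ∀ r c : ℕ, (r, c) ∈ lam → hookLength lam r c ≠ s

/-- `λ` equals its conjugate partition. -/
def IsSelfConjugate (lam : YoungDiagram) : Prop := lam.transpose = lam

/-- The `s`-set of `λ`: for each congruence class modulo `s`, the smallest integer in the class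
that does not lie in the beta-set. -/
def sSet (s : ℕ) (lam : YoungDiagram) : Set ℤ :=
  {a | IsLeast {b : ℤ | b ≡ a [ZMOD s] ∧ b ∉ betaSet lam} a}

/-- The self-conjugate `s`-cores. -/
@[ext]
structure SelfConjCore (s : ℕ) where
  /-- the underlying partition -/
  diagram : YoungDiagram
  isCore : IsCore s diagram
  isSelfConjugate : IsSelfConjugate diagram

/-- The self-conjugate `s`-cores `λ` with `k - l < N s` for all `k, l` in the `s`-set of `λ`. -/
@[ext]
structure BoundedSelfConjCore (s N : ℕ) where
  /-- the underlying self-conjugate `s`-core -/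
  core : SelfConjCore s
  spread_lt : ∀ k ∈ sSet s core.diagram, ∀ l ∈ sSet s core.diagram, k - l < (N : ℤ) * s

/-- The equivalence relation `≡_N` on `s`-cores: there is a bijection between the `s`-sets
that fixes every element modulo `N s`. -/
def CoreEquiv (s N : ℕ) (lam mu : YoungDiagram) : Prop :=
  ∃ φ : sSet s lam ≃ sSet s mu, ∀ k : sSet s lam, (φ k : ℤ) ≡ (k : ℤ) [ZMOD ((N : ℤ) * s)]

theorem betaSet_injective : Function.Injective betaSet := by
  intro lam mu h
  have key : (fun i : ℕ => -((lam.rowLen i : ℤ) - (i + 1)))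
      = fun i : ℕ => -((mu.rowLen i : ℤ) - (i + 1)) := by
    have mono : ∀ nu : YoungDiagram,
        StrictMono (fun i : ℕ => -((nu.rowLen i : ℤ) - (i + 1))) := by
      intro nu
      refine strictMono_nat_of_lt_succ fun i => ?_
      have := nu.rowLen_anti i (i + 1) (Nat.le_succ i)
      push_cast
      omega
    refine (StrictMono.range_inj (mono lam) (mono mu)).1 ?_
    have e : ∀ nu : YoungDiagram,
        Set.range (fun i : ℕ => -((nu.rowLen i : ℤ) - (i + 1))) = Neg.neg '' betaSet nu := by
      intro nu
      rw [betaSet, ← Set.range_comp]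
      rfl
    rw [e, e, h]
  ext ⟨i, j⟩
  have hi := congrFun key i
  simp only [YoungDiagram.mem_cells, YoungDiagram.mem_iff_lt_rowLen]
  omega

theorem notMem_betaSet_iff (lam : YoungDiagram) (x : ℤ) :
    x ∉ betaSet lam ↔ ∃ j : ℕ, x = (j : ℤ) - lam.colLen j := by
  have cell : ∀ r j : ℕ, j < lam.rowLen r ↔ r < lam.colLen j := fun r j => by
    rw [← YoungDiagram.mem_iff_lt_rowLen, ← YoungDiagram.mem_iff_lt_colLen]
  constructor
  · intro hx
    have ex : ∃ r : ℕ, (lam.rowLen r : ℤ) - (r + 1) < x := by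
      refine ⟨lam.rowLen 0 + x.natAbs, ?_⟩
      have := lam.rowLen_anti 0 (lam.rowLen 0 + x.natAbs) (Nat.zero_le _)
      have := neg_abs_le x
      push_cast
      omega
    classical
    obtain ⟨h1, h2⟩ := Nat.find_spec ex, @Nat.find_min _ _ ex
    set r := Nat.find ex with hr
    have hnn : 0 ≤ x + r := by omega
    refine ⟨(x + r).toNat, ?_⟩
    have hle : lam.colLen (x + r).toNat ≤ r := by
      by_contra hlt
      rw [not_le, ← cell] at hlt
      omega
    have hge : r ≤ lam.colLen (x + r).toNat := by
      rcases Nat.eq_zero_or_pos r with h0 | hpos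
      · omega
      · have h3 := h2 (m := r - 1) (by omega)
        have h4 : (lam.rowLen (r - 1) : ℤ) - ((r - 1 : ℕ) + 1) ≠ x := fun h => hx ⟨r - 1, h⟩
        have h5 : (x + r).toNat < lam.rowLen (r - 1) := by omega
        rw [cell] at h5
        omega
    omega
  · rintro ⟨j, rfl⟩ ⟨r, hr⟩
    have := cell r j
    simp only at hr
    omega

theorem mem_betaSet_transpose (lam : YoungDiagram) (x : ℤ) :
    x ∈ betaSet lam.transpose ↔ -1 - x ∉ betaSet lam := by
  rw [notMem_betaSet_iff]
  simp only [betaSet, Set.mem_range, YoungDiagram.rowLen_transpose]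
  constructor
  · rintro ⟨i, hi⟩
    exact ⟨i, by omega⟩
  · rintro ⟨i, hi⟩
    exact ⟨i, by omega⟩

theorem isSelfConjugate_iff (lam : YoungDiagram) :
    IsSelfConjugate lam ↔ ∀ x, x ∈ betaSet lam ↔ -1 - x ∉ betaSet lam := by
  rw [IsSelfConjugate, ← betaSet_injective.eq_iff, Set.ext_iff]
  simp only [mem_betaSet_transpose]
  exact forall_congr' fun x => Iff.comm

theorem isCore_iff {s : ℕ} (hs : 0 < s) (lam : YoungDiagram) :
    IsCore s lam ↔ ∀ b ∈ betaSet lam, b - s ∈ betaSet lam := by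
  constructor
  · rintro h _ ⟨r, rfl⟩
    by_contra hb
    obtain ⟨j, hj⟩ := (notMem_betaSet_iff _ _).1 hb
    simp only at hj
    have cell : j < lam.rowLen r ↔ r < lam.colLen j := by
      rw [← YoungDiagram.mem_iff_lt_rowLen, ← YoungDiagram.mem_iff_lt_colLen]
    refine h r j (YoungDiagram.mem_iff_lt_rowLen.2 (by omega)) ?_
    rw [hookLength]
    omega
  · intro h r c hrc heq
    have hb : (lam.rowLen r : ℤ) - (r + 1) - s ∉ betaSet lam :=
      (notMem_betaSet_iff _ _).2 ⟨c, by rw [hookLength] at heq; omega⟩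
    exact hb (h _ ⟨r, rfl⟩)

theorem exists_rowLen_eq (f : ℕ → ℕ) (hf : Antitone f) (M : ℕ) (hM : ∀ i, M ≤ i → f i = 0) :
    ∃ lam : YoungDiagram, ∀ i, lam.rowLen i = f i := by
  let lam : YoungDiagram :=
    { cells := (Finset.range M ×ˢ Finset.range (f 0)).filter fun p => p.2 < f p.1
      isLowerSet := by
        rintro ⟨a, b⟩ ⟨c, d⟩ ⟨h1, h2⟩ h
        simp only [Finset.coe_filter, Finset.mem_product, Finset.mem_range,
          Set.mem_ofPred_eq] at h h1 h2 ⊢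
        have := hf h1
        have := hf (Nat.zero_le c)
        omega }
  have hm : ∀ i j, (i, j) ∈ lam ↔ j < f i := by
    intro i j
    rw [← YoungDiagram.mem_cells]
    simp only [lam, Finset.mem_filter, Finset.mem_product, Finset.mem_range]
    have := hf (Nat.zero_le i)
    have := hM i
    omega
  refine ⟨lam, fun i => ?_⟩
  have h : ∀ j, j < lam.rowLen i ↔ j < f i := fun j => by
    rw [← YoungDiagram.mem_iff_lt_rowLen, hm]
  have h1 := h (f i)
  have h2 := h (lam.rowLen i)
  omega

/-- A set of integers that is bounded above and symmetric is the beta-set of a partition. -/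
theorem exists_betaSet_eq (X : Set ℤ) (hsym : ∀ x, x ∈ X ↔ -1 - x ∉ X) (hbd : BddAbove X) :
    ∃ lam : YoungDiagram, betaSet lam = X := by
  classical
  obtain ⟨B, hB⟩ : ∃ B : ℕ, ∀ x ∈ X, x ≤ B := by
    obtain ⟨b, hb⟩ := hbd
    exact ⟨b.toNat, fun x hx => (hb hx).trans (Int.self_le_toNat b)⟩
  have hlow : ∀ x : ℤ, x < -1 - B → x ∈ X := by
    intro x hx
    rw [hsym]
    intro h
    have := hB _ h
    omega
  let p : ℕ → Prop := fun k => (B : ℤ) - k ∈ X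
  have hcount : ∀ L : ℕ, B < L → Nat.count p (B + 1 + L) = L := by
    intro L hL
    rw [Nat.count_eq_card_filter_range]
    have e1 : ((Finset.range (B + 1 + L)).filter p).card
        = ((Finset.Ico (-(L : ℤ)) L).filter (· ∈ X)).card := by
      refine Finset.card_bij' (fun k _ => (B : ℤ) - k) (fun x _ => ((B : ℤ) - x).toNat)
        ?_ ?_ ?_ ?_
      · intro k hk
        simp only [Finset.mem_filter, Finset.mem_range, Finset.mem_Ico, p] at hk ⊢
        exact ⟨by omega, hk.2⟩
      · intro x hx
        simp only [Finset.mem_filter, Finset.mem_range, Finset.mem_Ico, p] at hx ⊢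
        have := hB x hx.2
        have e : (B : ℤ) - (((B : ℤ) - x).toNat : ℤ) = x := by omega
        exact ⟨by omega, by rw [e]; exact hx.2⟩
      · intro k hk
        simp
      · intro x hx
        simp only [Finset.mem_filter, Finset.mem_Ico] at hx
        have := hB x hx.2
        omega
    have e2 : ((Finset.Ico (-(L : ℤ)) L).filter (· ∈ X)).card
        = ((Finset.Ico (-(L : ℤ)) L).filter (· ∉ X)).card := by
      refine Finset.card_bij' (fun x _ => -1 - x) (fun x _ => -1 - x) ?_ ?_ ?_ ?_
      · intro x hx
        simp only [Finset.mem_filter, Finset.mem_Ico] at hx ⊢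
        exact ⟨by omega, (hsym x).1 hx.2⟩
      · intro x hx
        simp only [Finset.mem_filter, Finset.mem_Ico] at hx ⊢
        refine ⟨by omega, (hsym _).2 ?_⟩
        have e : -1 - (-1 - x) = x := by ring
        rw [e]
        exact hx.2
      · intro x _
        ring
      · intro x _
        ring
    have e3 := Finset.card_filter_add_card_filter_not (s := Finset.Ico (-(L : ℤ)) L) (· ∈ X)
    have e4 : (Finset.Ico (-(L : ℤ)) L).card = 2 * L := by
      rw [Int.card_Ico]
      omega
    have e5 : ((Finset.range (B + 1 + L)).filter p).card = L := by omega
    convert e5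
  have hinf : Set.Infinite {k | p k} := by
    refine Set.infinite_of_not_bddAbove ?_
    rintro ⟨b, hb⟩
    have : b + 2 * B + 2 ∈ {k | p k} := by
      apply hlow
      push_cast
      omega
    have := hb this
    omega
  have hmono : StrictMono (Nat.nth p) := Nat.nth_strictMono hinf
  have hrange : Set.range (Nat.nth p) = {k | p k} := Nat.range_nth_of_infinite hinf
  have hnth : ∀ L : ℕ, B < L → Nat.nth p L = B + 1 + L := by
    intro L hL
    have hp : p (B + 1 + L) := by
      apply hlow
      push_cast
      omega
    have := Nat.nth_count hp
    rwa [hcount L hL] at this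
  have hle : ∀ i, Nat.nth p i ≤ B + 1 + i := by
    intro i
    have h1 : ∀ d, Nat.nth p i + d ≤ Nat.nth p (i + d) := by
      intro d
      induction d with
      | zero => simp
      | succ d ih =>
        have := hmono (show i + d < i + (d + 1) by omega)
        omega
    have h2 := h1 (B + 1)
    rw [hnth (i + (B + 1)) (by omega)] at h2
    omega
  obtain ⟨lam, hlam⟩ := exists_rowLen_eq (fun i => B + 1 + i - Nat.nth p i)
    (by
      refine antitone_nat_of_succ_le fun i => ?_
      have := hmono (Nat.lt_succ_self i)
      have := hle i
      have := hle (i + 1)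
      simp only [Nat.succ_eq_add_one] at *
      omega)
    (B + 1) (fun i hi => by
      have := hnth i (by omega)
      omega)
  refine ⟨lam, ?_⟩
  have hval : ∀ i : ℕ, (lam.rowLen i : ℤ) - (i + 1) = (B : ℤ) - Nat.nth p i := by
    intro i
    rw [hlam]
    have := hle i
    omega
  ext x
  simp only [betaSet, Set.mem_range, hval]
  constructor
  · rintro ⟨i, rfl⟩
    have : Nat.nth p i ∈ {k | p k} := hrange ▸ Set.mem_range_self i
    exact this
  · intro hx
    have hxB := hB x hx
    have : (B - x).toNat ∈ {k | p k} := by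
      change (B : ℤ) - (((B : ℤ) - x).toNat : ℤ) ∈ X
      have e : (B : ℤ) - (((B : ℤ) - x).toNat : ℤ) = x := by omega
      rwa [e]
    rw [← hrange] at this
    obtain ⟨i, hi⟩ := this
    exact ⟨i, by rw [hi]; omega⟩

/-! ### Basic facts on `s`-sets of self-conjugate cores -/

theorem betaSet_bddAbove (lam : YoungDiagram) : BddAbove (betaSet lam) := by
  refine ⟨lam.rowLen 0, ?_⟩
  rintro _ ⟨i, rfl⟩
  have := lam.rowLen_anti 0 i (Nat.zero_le _)
  simp only
  omega

theorem sub_mul_mem {s : ℕ} {X : Set ℤ} (h : ∀ b ∈ X, b - s ∈ X) (b : ℤ) (hb : b ∈ X) (k : ℕ) :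
    b - s * k ∈ X := by
  induction k with
  | zero => simpa using hb
  | succ k ih =>
    have := h _ ih
    have e : b - (s : ℤ) * ((k + 1 : ℕ) : ℤ) = b - s * k - s := by push_cast; ring
    rwa [e]

theorem mem_of_modEq {s : ℕ} (hs : 0 < s) {X : Set ℤ} (h : ∀ b ∈ X, b - s ∈ X) {a b : ℤ}
    (hb : b ∈ X) (hab : a ≡ b [ZMOD s]) (hle : a ≤ b) : a ∈ X := by
  obtain ⟨k, hk⟩ := hab.dvd
  have hk0 : 0 ≤ k := by
    by_contra hneg
    have : (s : ℤ) * k < 0 := mul_neg_of_pos_of_neg (by exact_mod_cast hs) (by omega)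
    omega
  have := sub_mul_mem h b hb k.toNat
  rw [Int.toNat_of_nonneg hk0] at this
  have e : b - (s : ℤ) * k = a := by omega
  rwa [e] at this

namespace SelfConjCore

variable {s : ℕ} (lam : SelfConjCore s)

theorem sub_mem (hs : 0 < s) : ∀ b ∈ betaSet lam.1, b - s ∈ betaSet lam.1 :=
  (isCore_iff hs _).1 lam.2

theorem mem_symm (x : ℤ) : x ∈ betaSet lam.1 ↔ -1 - x ∉ betaSet lam.1 :=
  (isSelfConjugate_iff _).1 lam.3 x

theorem mem_sSet_iff (hs : 0 < s) (a : ℤ) :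
    a ∈ sSet s lam.1 ↔ a ∉ betaSet lam.1 ∧ a - s ∈ betaSet lam.1 := by
  constructor
  · rintro ⟨⟨_, h1⟩, h2⟩
    refine ⟨h1, ?_⟩
    by_contra h3
    have : a ≤ a - s := h2 ⟨by simp [Int.ModEq], h3⟩
    omega
  · rintro ⟨h1, h2⟩
    refine ⟨⟨Int.ModEq.refl _, h1⟩, ?_⟩
    rintro b ⟨hb, hb'⟩
    by_contra hlt
    rw [not_le] at hlt
    apply hb'
    refine mem_of_modEq hs (lam.sub_mem hs) h2 (hb.trans (by simp [Int.ModEq])) ?_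
    obtain ⟨k, hk⟩ := hb.dvd
    have hk0 : 1 ≤ k := by
      by_contra hneg
      have : (s : ℤ) * k ≤ 0 :=
        mul_nonpos_of_nonneg_of_nonpos (by exact_mod_cast hs.le) (by omega)
      omega
    have : (s : ℤ) * 1 ≤ s * k := mul_le_mul_of_nonneg_left hk0 (by exact_mod_cast hs.le)
    omega

theorem mem_betaSet_iff (hs : 0 < s) {a m : ℤ} (ha : a ∈ sSet s lam.1) (hm : m ≡ a [ZMOD s]) :
    m ∈ betaSet lam.1 ↔ m < a := by
  have ha' := (lam.mem_sSet_iff hs a).1 ha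
  constructor
  · intro h
    by_contra hle
    exact ha'.1 (mem_of_modEq hs (lam.sub_mem hs) h hm.symm (by omega))
  · intro h
    by_contra hm'
    have := ha.2 ⟨hm, hm'⟩
    omega

theorem sSet_unique (hs : 0 < s) {a b : ℤ} (ha : a ∈ sSet s lam.1) (hb : b ∈ sSet s lam.1)
    (hab : a ≡ b [ZMOD s]) : a = b := by
  have h1 := lam.mem_betaSet_iff hs ha hab.symm
  have h2 := lam.mem_betaSet_iff hs hb hab
  have h3 := ((lam.mem_sSet_iff hs a).1 ha).1
  have h4 := ((lam.mem_sSet_iff hs b).1 hb).1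
  rw [h1] at h4
  rw [h2] at h3
  omega

theorem exists_sSet (hs : 0 < s) (m : ℤ) : ∃ a ∈ sSet s lam.1, m ≡ a [ZMOD s] := by
  obtain ⟨B, hB⟩ := betaSet_bddAbove lam.1
  have hs' : (1 : ℤ) ≤ s := by exact_mod_cast hs
  have hlow : ∀ x : ℤ, x < -1 - B → x ∈ betaSet lam.1 := by
    intro x hx
    rw [lam.mem_symm]
    intro h
    have := hB h
    omega
  obtain ⟨a, ⟨h1, h2⟩, h3⟩ := Int.exists_least_of_bdd
    (P := fun b => b ≡ m [ZMOD s] ∧ b ∉ betaSet lam.1)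
    ⟨-1 - B, fun z hz => by
      by_contra hlt
      exact hz.2 (hlow z (by omega))⟩
    ⟨m + s * (|B| + |m| + 1), by simp [Int.ModEq], fun h => by
      have h1 := hB h
      have h2 : 1 * (|B| + |m| + 1) ≤ s * (|B| + |m| + 1) :=
        mul_le_mul_of_nonneg_right hs' (by positivity)
      have := le_abs_self B
      have := neg_abs_le m
      omega⟩
  exact ⟨a, ⟨⟨Int.ModEq.refl _, h2⟩, fun b hb => h3 b ⟨hb.1.trans h1, hb.2⟩⟩, h1.symm⟩

theorem sSet_symm (hs : 0 < s) {a : ℤ} (ha : a ∈ sSet s lam.1) :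
    (s : ℤ) - 1 - a ∈ sSet s lam.1 := by
  rw [lam.mem_sSet_iff hs] at ha ⊢
  have h1 := lam.mem_symm (a - s)
  have h2 := lam.mem_symm (-1 - a)
  have e1 : -1 - (a - (s : ℤ)) = s - 1 - a := by ring
  have e2 : -1 - (-1 - a) = a := by ring
  have e3 : (s : ℤ) - 1 - a - s = -1 - a := by ring
  rw [e1] at h1
  rw [e2] at h2
  rw [e3]
  exact ⟨h1.1 ha.2, h2.2 ha.1⟩

theorem eq_of_sSet_subset (hs : 0 < s) {lam mu : SelfConjCore s}
    (h : ∀ a ∈ sSet s lam.1, a ∈ sSet s mu.1) : lam = mu := by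
  apply SelfConjCore.ext
  apply betaSet_injective
  ext m
  obtain ⟨a, ha, hm⟩ := lam.exists_sSet hs m
  rw [lam.mem_betaSet_iff hs ha hm, mu.mem_betaSet_iff hs (h a ha) hm]

theorem coreEquiv_iff (hs : 0 < s) (N : ℕ) (lam mu : SelfConjCore s) :
    CoreEquiv s N lam.1 mu.1 ↔ ∀ a ∈ sSet s lam.1, ∀ b ∈ sSet s mu.1,
      a ≡ b [ZMOD s] → a ≡ b [ZMOD ((N : ℤ) * s)] := by
  constructor
  · rintro ⟨φ, hφ⟩ a ha b hb hab
    have h1 := hφ ⟨a, ha⟩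
    have h2 : (φ ⟨a, ha⟩ : ℤ) = b :=
      mu.sSet_unique hs (φ ⟨a, ha⟩).2 hb
        ((h1.of_dvd (Dvd.intro_left _ rfl)).trans hab)
    rw [h2] at h1
    exact h1.symm
  · intro h
    choose f hf using fun a : sSet s lam.1 => mu.exists_sSet hs (a : ℤ)
    refine ⟨Equiv.ofBijective (fun a => ⟨f a, (hf a).1⟩) ⟨?_, ?_⟩, ?_⟩
    · intro a b hab
      have hab' : f a = f b := congrArg Subtype.val hab
      apply Subtype.ext
      refine lam.sSet_unique hs a.2 b.2 ?_
      exact (hf a).2.trans (hab' ▸ (hf b).2.symm)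
    · intro b
      obtain ⟨a, ha, hab⟩ := lam.exists_sSet hs (b : ℤ)
      refine ⟨⟨a, ha⟩, Subtype.ext ?_⟩
      exact mu.sSet_unique hs (hf ⟨a, ha⟩).1 b.2 ((hf ⟨a, ha⟩).2.symm.trans hab.symm)
    · intro a
      exact (h a a.2 _ (hf a).1 (hf a).2).symm

theorem coreEquiv_symm (hs : 0 < s) {N : ℕ} {lam mu : SelfConjCore s}
    (h : CoreEquiv s N lam.1 mu.1) : CoreEquiv s N mu.1 lam.1 := by
  rw [coreEquiv_iff hs] at h ⊢
  exact fun a ha b hb hab => (h b hb a ha hab.symm).symm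

theorem coreEquiv_trans (hs : 0 < s) {N : ℕ} {lam mu nu : SelfConjCore s}
    (h : CoreEquiv s N lam.1 mu.1) (h' : CoreEquiv s N mu.1 nu.1) :
    CoreEquiv s N lam.1 nu.1 := by
  rw [coreEquiv_iff hs] at h h' ⊢
  intro a ha b hb hab
  obtain ⟨c, hc, hac⟩ := mu.exists_sSet hs a
  exact (h a ha c hc hac).trans (h' c hc b hb (hac.symm.trans hab))

theorem two_mul_sub_lt (hs : 0 < s) {N : ℕ} {lam : SelfConjCore s}
    (h : ∀ k ∈ sSet s lam.1, ∀ l ∈ sSet s lam.1, k - l < (N : ℤ) * s) {a : ℤ}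
    (ha : a ∈ sSet s lam.1) :
    2 * a - (s - 1) < (N : ℤ) * s ∧ -((N : ℤ) * s) < 2 * a - (s - 1) := by
  have h1 := h a ha _ (lam.sSet_symm hs ha)
  have h2 := h _ (lam.sSet_symm hs ha) a ha
  constructor <;> linarith

theorem eq_of_coreEquiv (hs : 0 < s) {N : ℕ} {lam mu : SelfConjCore s}
    (hlam : ∀ k ∈ sSet s lam.1, ∀ l ∈ sSet s lam.1, k - l < (N : ℤ) * s)
    (hmu : ∀ k ∈ sSet s mu.1, ∀ l ∈ sSet s mu.1, k - l < (N : ℤ) * s)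
    (h : CoreEquiv s N lam.1 mu.1) : lam = mu := by
  rw [coreEquiv_iff hs] at h
  refine eq_of_sSet_subset hs fun a ha => ?_
  obtain ⟨b, hb, hab⟩ := mu.exists_sSet hs a
  have h1 := two_mul_sub_lt hs hlam ha
  have h2 := two_mul_sub_lt hs hmu hb
  have h3 : b - a = 0 := by
    refine Int.eq_zero_of_abs_lt_dvd (h a ha b hb hab).dvd ?_
    rw [abs_lt]
    constructor <;> linarith
  have h4 : a = b := by omega
  rwa [h4]

/-- Every class of self-conjugate `s`-cores under `≡_N` contains a core of bounded spread. -/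
theorem exists_bounded (hs : 0 < s) {N : ℕ} (hN : 0 < N) (lam : SelfConjCore s) :
    ∃ mu : BoundedSelfConjCore s N, CoreEquiv s N lam.1 mu.1.1 := by
  have hs' : (0 : ℤ) < s := by exact_mod_cast hs
  have hN' : (0 : ℤ) < N := by exact_mod_cast hN
  have hNs : (0 : ℤ) < (N : ℤ) * s := mul_pos hN' hs'
  set P : ℤ := (N : ℤ) * s with hP
  let f : ℤ → ℤ := fun a => a - P * ((2 * a - (s - 1) + P) / (2 * P))
  have fmod : ∀ a, f a ≡ a [ZMOD P] := fun a => by simp [f, Int.ModEq]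
  have fmods : ∀ a, f a ≡ a [ZMOD s] := fun a => (fmod a).of_dvd (Dvd.intro_left _ rfl)
  have flt : ∀ a, 2 * f a - (s - 1) < P := by
    intro a
    have h1 := Int.emod_add_mul_ediv (2 * a - (s - 1) + P) (2 * P)
    have h2 := Int.emod_lt_of_pos (2 * a - (s - 1) + P) (show 0 < 2 * P by omega)
    simp only [f]
    linarith
  have fge : ∀ a, -P ≤ 2 * f a - (s - 1) := by
    intro a
    have h1 := Int.emod_add_mul_ediv (2 * a - (s - 1) + P) (2 * P)
    have h2 := Int.emod_nonneg (2 * a - (s - 1) + P) (show 2 * P ≠ 0 by omega)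
    simp only [f]
    linarith
  have fgt : ∀ a ∈ sSet s lam.1, -P < 2 * f a - (s - 1) := by
    intro a ha
    refine lt_of_le_of_ne (fge a) fun heq => ?_
    have h1 : a ≡ s - 1 - a [ZMOD s] := by
      have h2 : f a ≡ s - 1 - f a [ZMOD s] := by
        rw [Int.modEq_iff_dvd]
        exact ⟨N, by rw [hP] at heq; linarith⟩
      exact (fmods a).symm.trans (h2.trans ((Int.ModEq.refl _).sub (fmods a)))
    have h3 := lam.sSet_unique hs ha (lam.sSet_symm hs ha) h1
    obtain ⟨k, hk⟩ := (fmod a).dvd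
    have h5 : P * (2 * k) = P * 1 := by linarith
    have h6 := mul_left_cancel₀ hNs.ne' h5
    omega
  have fsymm : ∀ a ∈ sSet s lam.1, f (s - 1 - a) = s - 1 - f a := by
    intro a ha
    have h1 := flt (s - 1 - a)
    have h2 := fgt _ (lam.sSet_symm hs ha)
    have h3 := flt a
    have h4 := fgt a ha
    have h5 : f (s - 1 - a) ≡ s - 1 - f a [ZMOD P] :=
      (fmod _).trans ((Int.ModEq.refl _).sub (fmod a).symm)
    have h6 : s - 1 - f a - f (s - 1 - a) = 0 := by
      refine Int.eq_zero_of_abs_lt_dvd h5.dvd ?_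
      rw [abs_lt]
      constructor <;> linarith
    omega
  let X : Set ℤ := {m | ∃ a ∈ sSet s lam.1, m ≡ a [ZMOD s] ∧ m < f a}
  have hX : ∀ {m a : ℤ}, a ∈ sSet s lam.1 → m ≡ a [ZMOD s] → (m ∈ X ↔ m < f a) := by
    intro m a ha hm
    constructor
    · rintro ⟨b, hb, hmb, hlt⟩
      rwa [lam.sSet_unique hs ha hb (hm.symm.trans hmb)]
    · exact fun h => ⟨a, ha, hm, h⟩
  have hXsub : ∀ b ∈ X, b - s ∈ X := by
    rintro b ⟨a, ha, hm, hlt⟩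
    exact ⟨a, ha, Int.ModEq.trans (by simp [Int.ModEq]) hm, by omega⟩
  have hXsymm : ∀ m, m ∈ X ↔ -1 - m ∉ X := by
    intro m
    obtain ⟨a, ha, hm⟩ := lam.exists_sSet hs m
    have hm' : -1 - m ≡ s - 1 - a [ZMOD s] := by
      have := (Int.ModEq.refl (n := (s : ℤ)) (-1)).sub hm
      refine this.trans ?_
      rw [Int.modEq_iff_dvd]
      exact ⟨1, by ring⟩
    rw [hX ha hm, hX (lam.sSet_symm hs ha) hm', fsymm a ha]
    obtain ⟨k, hk⟩ := ((fmods a).trans hm.symm).dvd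
    constructor
    · intro h1 h2
      have h3 : (s : ℤ) * k < s * 0 := by linarith
      have h4 : (s : ℤ) * (-1) < s * k := by linarith
      have := lt_of_mul_lt_mul_left h3 hs'.le
      have := lt_of_mul_lt_mul_left h4 hs'.le
      omega
    · intro h1
      omega
  have hXbdd : BddAbove X := by
    refine ⟨P + s, ?_⟩
    rintro m ⟨a, _, _, hlt⟩
    have := flt a
    linarith
  obtain ⟨mu0, hmu0⟩ := exists_betaSet_eq X hXsymm hXbdd
  let mu : SelfConjCore s := ⟨mu0, (isCore_iff hs _).2 (by rw [hmu0]; exact hXsub),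
    (isSelfConjugate_iff _).2 (by rw [hmu0]; exact hXsymm)⟩
  have hmu : betaSet mu.1 = X := hmu0
  have hfmem : ∀ a ∈ sSet s lam.1, f a ∈ sSet s mu.1 := by
    intro a ha
    rw [mu.mem_sSet_iff hs, hmu, hX ha (fmods a),
      hX ha (Int.ModEq.trans (by simp [Int.ModEq]) (fmods a))]
    omega
  have hfsurj : ∀ b ∈ sSet s mu.1, ∃ a ∈ sSet s lam.1, b = f a := by
    intro b hb
    obtain ⟨a, ha, hab⟩ := lam.exists_sSet hs b
    exact ⟨a, ha, mu.sSet_unique hs hb (hfmem a ha) (hab.trans (fmods a).symm)⟩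
  refine ⟨⟨mu, ?_⟩, ?_⟩
  · intro k hk l hl
    obtain ⟨a, ha, rfl⟩ := hfsurj k hk
    obtain ⟨b, hb, rfl⟩ := hfsurj l hl
    have := flt a
    have := fgt b hb
    linarith
  · rw [coreEquiv_iff hs]
    intro a ha b hb hab
    obtain ⟨c, hc, rfl⟩ := hfsurj b hb
    have : a = c := lam.sSet_unique hs ha hc (hab.trans (fmods c))
    subst this
    exact (fmod a).symm

end SelfConjCore

/-! ### The affine symmetric group and the affine hyperoctahedral group -/

theorem periodic_add_mul {s : ℕ} {w : ℤ → ℤ} (hw : ∀ m, w (m + s) = w m + s) (m k : ℤ) :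
    w (m + s * k) = w m + s * k := by
  induction k using Int.induction_on with
  | zero => simp
  | succ k ih =>
    have := hw (m + s * k)
    rw [ih] at this
    rw [show m + (s : ℤ) * ((k : ℤ) + 1) = m + s * k + s by ring, this]
    ring
  | pred k ih =>
    have := hw (m + s * (-(k : ℤ) - 1))
    rw [show m + (s : ℤ) * (-(k : ℤ) - 1) + s = m + s * (-(k : ℤ)) by ring, ih] at this
    linarith

theorem periodic_inv {s : ℕ} {w : Equiv.Perm ℤ} (hw : ∀ m, w (m + s) = w m + s) (m : ℤ) :
    w⁻¹ (m + s) = w⁻¹ m + s := by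
  apply w.injective
  rw [hw]
  simp

theorem periodic_modEq {s : ℕ} {w : ℤ → ℤ} (hw : ∀ m, w (m + s) = w m + s) {N m m' : ℤ}
    (h : m ≡ m' [ZMOD (N * s)]) : w m ≡ w m' [ZMOD (N * s)] := by
  obtain ⟨k, hk⟩ := h.dvd
  have e : m' = m + s * (N * k) := by linarith
  rw [e, periodic_add_mul hw, Int.modEq_iff_dvd]
  exact ⟨k, by ring⟩

theorem sum_comp_periodic {s : ℕ} (w : Equiv.Perm ℤ) (hw : ∀ m, w (m + s) = w m + s)
    (f : ℤ → ℤ) (hf : ∀ m k : ℤ, f (m + s * k) = f m) :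
    ∑ m ∈ Finset.range s, f (w m) = ∑ m ∈ Finset.range s, f m := by
  rcases Nat.eq_zero_or_pos s with rfl | hs
  · simp
  have hs' : (0 : ℤ) < s := by exact_mod_cast hs
  have hfm : ∀ m : ℤ, f (m % s) = f m := fun m => by
    have := hf (m % s) (m / s)
    rwa [Int.emod_add_mul_ediv, eq_comm] at this
  have step : ∀ v : Equiv.Perm ℤ, (∀ m, v (m + s) = v m + s) → ∀ m : ℤ,
      v (m % s) % s = v m % s := by
    intro v hv m
    have := periodic_add_mul hv (m % s) (m / s)
    rw [Int.emod_add_mul_ediv] at this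
    rw [this]
    simp
  have cast : ∀ m : ℤ, ((m % s).toNat : ℤ) = m % s := fun m =>
    Int.toNat_of_nonneg (Int.emod_nonneg _ hs'.ne')
  have mem : ∀ m : ℤ, (m % s).toNat ∈ Finset.range s := fun m => by
    have := Int.emod_lt_of_pos m hs'
    have := cast m
    rw [Finset.mem_range]
    omega
  refine Finset.sum_bij' (fun m _ => (w m % s).toNat) (fun m _ => (w⁻¹ m % s).toNat)
    (fun m _ => mem _) (fun m _ => mem _) ?_ ?_ ?_
  · intro m hm
    rw [Finset.mem_range] at hm
    rw [cast, step w⁻¹ (periodic_inv hw)]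
    rw [Equiv.Perm.inv_def, Equiv.symm_apply_apply]
    rw [Int.emod_eq_of_lt (by omega) (by omega)]
    simp
  · intro m hm
    rw [Finset.mem_range] at hm
    rw [cast, step w hw]
    rw [Equiv.Perm.inv_def, Equiv.apply_symm_apply]
    rw [Int.emod_eq_of_lt (by omega) (by omega)]
    simp
  · intro m _
    rw [cast, hfm]

theorem sum_range_cast (s : ℕ) :
    ∑ m ∈ Finset.range s, (m : ℤ) = (s.choose 2 : ℤ) := by
  rw [Nat.choose_two_right, ← Finset.sum_range_id]
  push_cast
  rfl

/-- The affine symmetric group of degree `s`: the permutations `w` of `ℤ` with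
`w (m + s) = w m + s` for all `m` and `w 0 + ⋯ + w (s - 1) = s.choose 2`. -/
def AffineSymm (s : ℕ) : Subgroup (Equiv.Perm ℤ) where
  carrier := {w | (∀ m, w (m + s) = w m + s) ∧
    ∑ m ∈ Finset.range s, w (m : ℤ) = (s.choose 2 : ℤ)}
  one_mem' := by
    refine ⟨fun m => rfl, ?_⟩
    exact sum_range_cast s
  mul_mem' := by
    rintro v w ⟨hv1, hv2⟩ ⟨hw1, hw2⟩
    refine ⟨fun m => by rw [Equiv.Perm.mul_apply, hw1, hv1, Equiv.Perm.mul_apply], ?_⟩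
    have key := sum_comp_periodic w hw1 (fun m => v m - m)
      (fun m k => by rw [periodic_add_mul hv1]; ring)
    have hid := sum_range_cast s
    simp only [Finset.sum_sub_distrib] at key
    simp only [Equiv.Perm.mul_apply]
    linarith
  inv_mem' := by
    rintro w ⟨hw1, hw2⟩
    refine ⟨periodic_inv hw1, ?_⟩
    have key := sum_comp_periodic w hw1 (fun m => w⁻¹ m - m)
      (fun m k => by rw [periodic_add_mul (periodic_inv hw1)]; ring)
    simp only [Finset.sum_sub_distrib, Equiv.Perm.inv_def, Equiv.symm_apply_apply] at key
    have hid := sum_range_cast s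
    simp only [Equiv.Perm.inv_def]
    linarith

theorem AffineSymm.periodic {s : ℕ} (w : AffineSymm s) (m : ℤ) :
    (w : Equiv.Perm ℤ) (m + s) = (w : Equiv.Perm ℤ) m + s := w.2.1 m

/-- The function `m ↦ m + 1` on the class `i - 1`, `m ↦ m - 1` on the class `i`, and the identity
on the other classes modulo `s`. -/
def genWFun {s : ℕ} (i : ZMod s) (m : ℤ) : ℤ :=
  if (m : ZMod s) = i - 1 then m + 1 else if (m : ZMod s) = i then m - 1 else m

theorem zmod_one_ne_zero {s : ℕ} (hs : 2 ≤ s) : (1 : ZMod s) ≠ 0 := by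
  have : Fact (1 < s) := ⟨hs⟩
  exact one_ne_zero

theorem sub_one_ne {s : ℕ} (h1 : (1 : ZMod s) ≠ 0) (i : ZMod s) : i - 1 ≠ i := fun h =>
  h1 (by linear_combination -h)

theorem genWFun_spec {s : ℕ} (h1 : (1 : ZMod s) ≠ 0) (i : ZMod s) (m : ℤ) :
    ((m : ZMod s) = i - 1 ∧ genWFun i m = m + 1 ∧ ((genWFun i m : ℤ) : ZMod s) = i) ∨
    ((m : ZMod s) = i ∧ genWFun i m = m - 1 ∧ ((genWFun i m : ℤ) : ZMod s) = i - 1) ∨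
    ((m : ZMod s) ≠ i ∧ (m : ZMod s) ≠ i - 1 ∧ genWFun i m = m) := by
  have hi := (sub_one_ne h1 i).symm
  by_cases ha : (m : ZMod s) = i - 1
  · left
    simp [genWFun, ha]
  · right
    by_cases hb : (m : ZMod s) = i
    · left
      simp [genWFun, hb, hi]
    · right
      simp [genWFun, ha, hb]

theorem genWFun_involutive {s : ℕ} (hs : 2 ≤ s) (i : ZMod s) :
    Function.Involutive (genWFun i) := by
  have h1 := zmod_one_ne_zero hs
  have hi := sub_one_ne h1 i
  intro m
  rcases genWFun_spec h1 i m with h | h | h <;>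
  rcases genWFun_spec h1 i (genWFun i m) with h' | h' | h' <;> grind

theorem genWFun_periodic {s : ℕ} (i : ZMod s) (m : ℤ) :
    genWFun i (m + s) = genWFun i m + s := by
  simp only [genWFun, Int.cast_add, Int.cast_natCast, CharP.cast_eq_zero, add_zero]
  split_ifs <;> ring

/-- The generator `w_i` of the affine symmetric group. -/
def genW {s : ℕ} (hs : 2 ≤ s) (i : ZMod s) : AffineSymm s :=
  ⟨(genWFun_involutive hs i).toPerm, genWFun_periodic i, by
    have key := sum_comp_periodic (genWFun_involutive hs i).toPerm (genWFun_periodic i)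
      (fun m => genWFun i m - m)
      (fun m k => by rw [periodic_add_mul (genWFun_periodic i)]; ring)
    have hinv : ∀ m, genWFun i (genWFun i m) = m := genWFun_involutive hs i
    have hid := sum_range_cast s
    simp only [Finset.sum_sub_distrib, Function.Involutive.coe_toPerm,
      hinv] at key
    simp only [Function.Involutive.coe_toPerm]
    linarith⟩

/-- With `u = ⌊s / 2⌋`: `v_i = w_i` if `i = 0`, `v_i = w_i w_{-i} w_i` if `i = u` or `i = -u`,
and `v_i = w_i w_{-i}` for the other classes `i` modulo `s`. -/
def genV {s : ℕ} (hs : 2 ≤ s) (i : ZMod s) : AffineSymm s :=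
  if i = 0 then genW hs i
  else if i = ((s / 2 : ℕ) : ZMod s) ∨ i = -((s / 2 : ℕ) : ZMod s) then
    genW hs i * genW hs (-i) * genW hs i
  else genW hs i * genW hs (-i)

/-- The affine hyperoctahedral group, as the subgroup of the affine symmetric group generated
by the elements `v_i`. -/
def AffineHyp {s : ℕ} (hs : 2 ≤ s) : Subgroup (AffineSymm s) :=
  Subgroup.closure (Set.range (genV hs))

theorem genWFun_symm {s : ℕ} (hs : 2 ≤ s) (i : ZMod s) (m : ℤ) :
    genWFun i (-1 - m) = -1 - genWFun (-i) m := by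
  have h1 := zmod_one_ne_zero hs
  have hi := sub_one_ne h1 (-i)
  have e1 : ((-1 - m : ℤ) : ZMod s) = i - 1 ↔ (m : ZMod s) = -i := by
    push_cast
    constructor <;> intro h <;> linear_combination -h
  have e2 : ((-1 - m : ℤ) : ZMod s) = i ↔ (m : ZMod s) = -i - 1 := by
    push_cast
    constructor <;> intro h <;> linear_combination -h
  simp only [genWFun, e1, e2]
  split_ifs with ha hb hb
  · exact absurd (hb.symm.trans ha) hi
  all_goals ring

theorem genWFun_comm {s : ℕ} (i j : ZMod s) (h1 : (1 : ZMod s) ≠ 0) (h2 : i ≠ j)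
    (h3 : i ≠ j + 1) (h4 : j ≠ i + 1) (m : ℤ) :
    genWFun i (genWFun j m) = genWFun j (genWFun i m) := by
  have d1 : i - 1 ≠ j := fun h => h3 (by linear_combination h)
  have d2 : j - 1 ≠ i := fun h => h4 (by linear_combination h)
  have d3 : i - 1 ≠ j - 1 := fun h => h2 (by linear_combination h)
  rcases genWFun_spec h1 i m with h | h | h <;>
  rcases genWFun_spec h1 j m with h' | h' | h' <;>
  rcases genWFun_spec h1 i (genWFun j m) with k | k | k <;>
  rcases genWFun_spec h1 j (genWFun i m) with k' | k' | k' <;> grind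

theorem genWFun_braid {s : ℕ} (i : ZMod s) (h1 : (1 : ZMod s) ≠ 0) (h2 : (2 : ZMod s) ≠ 0)
    (m : ℤ) :
    genWFun i (genWFun (i + 1) (genWFun i m))
      = genWFun (i + 1) (genWFun i (genWFun (i + 1) m)) := by
  have d1 : i - 1 ≠ i := sub_one_ne h1 i
  have d2 : i + 1 ≠ i := fun h => h1 (by linear_combination h)
  have d3 : i + 1 ≠ i - 1 := fun h => h2 (by linear_combination h)
  have up : ∀ (x : ZMod s) (k : ℤ), (k : ZMod s) = x → ((k + 1 : ℤ) : ZMod s) = x + 1 :=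
    fun x k h => by push_cast; rw [h]
  have dn : ∀ (x : ZMod s) (k : ℤ), (k : ZMod s) = x → ((k - 1 : ℤ) : ZMod s) = x - 1 :=
    fun x k h => by push_cast; rw [h]
  have a1 : ∀ k : ℤ, (k : ZMod s) = i - 1 → genWFun i k = k + 1 := fun k h => by
    simp [genWFun, h]
  have a2 : ∀ k : ℤ, (k : ZMod s) = i → genWFun i k = k - 1 := fun k h => by
    simp [genWFun, h, d1.symm]
  have a3 : ∀ k : ℤ, (k : ZMod s) ≠ i - 1 → (k : ZMod s) ≠ i → genWFun i k = k :=
    fun k h h' => by simp [genWFun, h, h']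
  have b1 : ∀ k : ℤ, (k : ZMod s) = i → genWFun (i + 1) k = k + 1 := fun k h => by
    simp [genWFun, h]
  have b2 : ∀ k : ℤ, (k : ZMod s) = i + 1 → genWFun (i + 1) k = k - 1 := fun k h => by
    simp [genWFun, h, h1]
  have b3 : ∀ k : ℤ, (k : ZMod s) ≠ i → (k : ZMod s) ≠ i + 1 → genWFun (i + 1) k = k :=
    fun k h h' => by simp [genWFun, h, h']
  by_cases hm1 : (m : ZMod s) = i - 1
  · have e1 : ((m + 1 : ℤ) : ZMod s) = i := by rw [up _ _ hm1]; ring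
    have e2 : ((m + 1 + 1 : ℤ) : ZMod s) = i + 1 := up _ _ e1
    rw [a1 m hm1, b1 _ e1, a3 _ (by rw [e2]; exact d3) (by rw [e2]; exact d2),
      b3 m (by rw [hm1]; exact d1) (by rw [hm1]; exact d3.symm), a1 m hm1, b1 _ e1]
  by_cases hm2 : (m : ZMod s) = i
  · have e1 : ((m - 1 : ℤ) : ZMod s) = i - 1 := dn _ _ hm2
    have e2 : ((m + 1 : ℤ) : ZMod s) = i + 1 := up _ _ hm2
    rw [a2 m hm2, b3 _ (by rw [e1]; exact d1) (by rw [e1]; exact d3.symm), a1 _ e1, b1 m hm2,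
      a3 _ (by rw [e2]; exact d3) (by rw [e2]; exact d2), b2 _ e2]
    ring
  by_cases hm3 : (m : ZMod s) = i + 1
  · have e1 : ((m - 1 : ℤ) : ZMod s) = i := by rw [dn _ _ hm3]; ring
    have e2 : ((m - 1 - 1 : ℤ) : ZMod s) = i - 1 := dn _ _ e1
    rw [a3 m hm1 hm2, b2 m hm3, a2 _ e1,
      b3 _ (by rw [e2]; exact d1) (by rw [e2]; exact d3.symm)]
  · rw [a3 m hm1 hm2, b3 m hm2 hm3, a3 m hm1 hm2, b3 m hm2 hm3]

/-- In `ℤ / s`, the classes `i` for which `w_i` and `w_{-i}` may fail to commute are `0`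
and the classes of `u` and `-u`. -/
theorem zmod_class_cases {s : ℕ} (hs : 2 ≤ s) (i : ZMod s) (h0 : i ≠ 0)
    (hu : i ≠ ((s / 2 : ℕ) : ZMod s)) (hu' : i ≠ -((s / 2 : ℕ) : ZMod s)) :
    i ≠ -i ∧ i ≠ -i + 1 ∧ -i ≠ i + 1 := by
  have : NeZero s := ⟨by omega⟩
  have hk := ZMod.val_lt i
  set k := i.val with hkdef
  have hi : i = ((k : ℤ) : ZMod s) := by
    rw [hkdef]
    simp
  have z : ∀ x : ℤ, (x : ZMod s) = 0 ↔ (s : ℤ) ∣ x := fun x =>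
    ZMod.intCast_zmod_eq_zero_iff_dvd x s
  have g0 : k ≠ 0 := fun h => h0 (by rw [hi, h]; simp)
  have gu : k ≠ s / 2 := fun h => hu (by rw [hi, h, Int.cast_natCast])
  have gu' : k ≠ s - s / 2 := fun h => hu' (by
    rw [hi, h, Int.cast_natCast, Nat.cast_sub (by omega)]
    simp)
  have small : ∀ x : ℤ, -(s : ℤ) < x → x < 2 * s → (s : ℤ) ∣ x → x = 0 ∨ x = s := by
    rintro x hx1 hx2 ⟨c, rfl⟩
    have hs' : (0 : ℤ) < s := by omega
    have c1 : -1 < c := by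
      by_contra hc
      have := mul_le_mul_of_nonneg_left (show c ≤ -1 by omega) hs'.le
      omega
    have c2 : c < 2 := by
      by_contra hc
      have := mul_le_mul_of_nonneg_left (show 2 ≤ c by omega) hs'.le
      omega
    have : c = 0 ∨ c = 1 := by omega
    rcases this with rfl | rfl <;> simp
  refine ⟨fun h => ?_, fun h => ?_, fun h => ?_⟩
  · have := (z (2 * k)).1 (by push_cast; rw [hi] at h; push_cast at h; linear_combination h)
    have := small _ (by omega) (by omega) this
    omega
  · have := (z (2 * k - 1)).1 (by push_cast; rw [hi] at h; push_cast at h; linear_combination h)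
    have := small _ (by omega) (by omega) this
    omega
  · have := (z (2 * k + 1)).1 (by push_cast; rw [hi] at h; push_cast at h; linear_combination -h)
    have := small _ (by omega) (by omega) this
    omega

theorem genV_symm {s : ℕ} (hs : 2 ≤ s) (i : ZMod s) (m : ℤ) :
    (genV hs i : Equiv.Perm ℤ) (-1 - m) = -1 - (genV hs i : Equiv.Perm ℤ) m := by
  have h1 := zmod_one_ne_zero hs
  have gw : ∀ (j : ZMod s) (k : ℤ), (genW hs j : Equiv.Perm ℤ) k = genWFun j k :=
    fun j k => rfl
  unfold genV
  split_ifs with h0 hu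
  · subst h0
    rw [gw, gw, genWFun_symm hs, neg_zero]
  · simp only [Subgroup.coe_mul, Equiv.Perm.mul_apply, gw, genWFun_symm hs, neg_neg]
    congr 1
    rcases Nat.even_or_odd' s with ⟨r, hr | hr⟩
    · have hii : -i = i := by
        have hr2 : ((s / 2 : ℕ) : ZMod s) + ((s / 2 : ℕ) : ZMod s) = 0 := by
          rw [← Nat.cast_add, show s / 2 + s / 2 = s by omega]
          simp
        rcases hu with rfl | rfl
        · linear_combination -hr2
        · linear_combination hr2
      rw [hii]
    · have h2 : (2 : ZMod s) ≠ 0 := by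
        intro h
        have h' : ((2 : ℕ) : ZMod s) = 0 := by exact_mod_cast h
        rw [ZMod.natCast_eq_zero_iff] at h'
        have := Nat.le_of_dvd (by norm_num) h'
        omega
      have hr2 : ((s / 2 : ℕ) : ZMod s) + ((s / 2 : ℕ) : ZMod s) + 1 = 0 := by
        have : ((s / 2 + s / 2 + 1 : ℕ) : ZMod s) = 0 := by
          rw [show s / 2 + s / 2 + 1 = s by omega]
          simp
        exact_mod_cast this
      rcases hu with rfl | rfl
      · have e : -((s / 2 : ℕ) : ZMod s) = ((s / 2 : ℕ) : ZMod s) + 1 := by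
          linear_combination -hr2
        rw [e]
        exact (genWFun_braid _ h1 h2 m).symm
      · have e : -((s / 2 : ℕ) : ZMod s) = ((s / 2 : ℕ) : ZMod s) + 1 := by
          linear_combination -hr2
        rw [neg_neg, e]
        exact genWFun_braid _ h1 h2 m
  · simp only [Subgroup.coe_mul, Equiv.Perm.mul_apply, gw, genWFun_symm hs, neg_neg]
    congr 1
    rw [not_or] at hu
    obtain ⟨c1, c2, c3⟩ := zmod_class_cases hs i h0 hu.1 hu.2
    exact (genWFun_comm i (-i) h1 c1 c2 c3 m).symm

theorem AffineHyp.symm {s : ℕ} {hs : 2 ≤ s} (w : AffineHyp hs) (m : ℤ) :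
    (w.1 : Equiv.Perm ℤ) (-1 - m) = -1 - (w.1 : Equiv.Perm ℤ) m := by
  obtain ⟨w, hw⟩ := w
  change (w : Equiv.Perm ℤ) (-1 - m) = -1 - (w : Equiv.Perm ℤ) m
  induction hw using Subgroup.closure_induction generalizing m with
  | mem x hx =>
    obtain ⟨i, rfl⟩ := hx
    exact genV_symm hs i m
  | one => rfl
  | mul x y _ _ hx hy =>
    simp only [Subgroup.coe_mul, Equiv.Perm.mul_apply, hx, hy]
  | inv x _ hx =>
    apply (x : Equiv.Perm ℤ).injective
    rw [hx]
    simp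

/-! ### The level `t` action on `ℤ` -/

/-- The integer `½ (s - 1) (t - 1)`. -/
def levelShift (s t : ℕ) : ℤ := ((s : ℤ) - 1) * ((t : ℤ) - 1) / 2

theorem two_mul_levelShift {s t : ℕ} (hst : s.Coprime t) :
    2 * levelShift s t = ((s : ℤ) - 1) * ((t : ℤ) - 1) := by
  unfold levelShift
  refine Int.mul_ediv_cancel' ?_
  rcases Nat.even_or_odd s with h | h
  · have ht : Odd t := by
      rw [← Nat.not_even_iff_odd]
      intro ht
      have := Nat.dvd_gcd h.two_dvd ht.two_dvd
      rw [hst] at this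
      omega
    obtain ⟨r, hr⟩ := ht
    exact ⟨((s : ℤ) - 1) * r, by rw [hr]; push_cast; ring⟩
  · obtain ⟨r, hr⟩ := h
    exact ⟨r * ((t : ℤ) - 1), by rw [hr]; push_cast; ring⟩

/-- An integer `i` with `i t ≡ m + ½ (s - 1) (t - 1)` modulo `s`. -/
def levelIdx (s t : ℕ) (m : ℤ) : ℤ := (m + levelShift s t) * Nat.gcdA t s

theorem levelIdx_spec {s t : ℕ} (hst : s.Coprime t) (m : ℤ) :
    levelIdx s t m * t ≡ m + levelShift s t [ZMOD s] := by
  have h := Nat.gcd_eq_gcd_ab t s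
  rw [hst.symm] at h
  push_cast at h
  rw [Int.modEq_iff_dvd]
  refine ⟨(m + levelShift s t) * Nat.gcdB t s, ?_⟩
  unfold levelIdx
  linear_combination (m + levelShift s t) * h

theorem idx_unique {s t : ℕ} (hst : s.Coprime t) {i j : ℤ} (h : i * t ≡ j * t [ZMOD s]) :
    i ≡ j [ZMOD s] := by
  refine Int.ModEq.symm ((Int.modEq_iff_dvd).2 ?_)
  have h' := h.symm.dvd
  rw [← sub_mul] at h'
  refine IsCoprime.dvd_of_dvd_mul_right ?_ h'
  exact Nat.isCoprime_iff_coprime.2 hst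

/-- The map `m ↦ m + t (w i - i)`, where `i t ≡ m + ½ (s - 1) (t - 1)` modulo `s`. -/
def levelFun {s : ℕ} (t : ℕ) (w : AffineSymm s) (m : ℤ) : ℤ :=
  m + t * ((w : Equiv.Perm ℤ) (levelIdx s t m) - levelIdx s t m)

theorem levelFun_eq {s t : ℕ} (hst : s.Coprime t) (w : AffineSymm s) {m i : ℤ}
    (hi : i * t ≡ m + levelShift s t [ZMOD s]) :
    levelFun t w m = m + t * ((w : Equiv.Perm ℤ) i - i) := by
  obtain ⟨k, hk⟩ := (idx_unique hst ((levelIdx_spec hst m).trans hi.symm)).dvd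
  have e : i = levelIdx s t m + s * k := by omega
  rw [e, periodic_add_mul (AffineSymm.periodic w), levelFun]
  ring

/-- The level `t` action of the affine symmetric group on `ℤ`. It is characterised on the
generators `w_i` by `levelHom_genW`. -/
def levelHom {s t : ℕ} (hst : s.Coprime t) : AffineSymm s →* Equiv.Perm ℤ :=
  MonoidHom.toHomPerm
    { toFun := fun w => levelFun t w
      map_one' := by
        funext m
        change levelFun t 1 m = m
        simp [levelFun]
      map_mul' := fun v w => by
        funext m
        have hi : (w : Equiv.Perm ℤ) (levelIdx s t m) * t
            ≡ levelFun t w m + levelShift s t [ZMOD s] := by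
          have h := levelIdx_spec hst m
          rw [Int.modEq_iff_dvd] at h ⊢
          convert! h using 1
          rw [levelFun]
          ring
        change levelFun t (v * w) m = levelFun t v (levelFun t w m)
        rw [levelFun_eq hst v hi]
        simp only [levelFun, Subgroup.coe_mul, Equiv.Perm.mul_apply]
        ring }

theorem levelHom_apply {s t : ℕ} (hst : s.Coprime t) (w : AffineSymm s) {m i : ℤ}
    (hi : i * t ≡ m + levelShift s t [ZMOD s]) :
    levelHom hst w m = m + t * ((w : Equiv.Perm ℤ) i - i) :=
  levelFun_eq hst w hi

/-- On generators, the level `t` action is given by `m ↦ m + t` on the class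
`(i - 1) t - ½ (s - 1) (t - 1)`, by `m ↦ m - t` on the class `i t - ½ (s - 1) (t - 1)`,
and by the identity on the other classes modulo `s`. -/
theorem levelHom_genW {s t : ℕ} (hs : 2 ≤ s) (hst : s.Coprime t) (i : ZMod s) (m : ℤ) :
    levelHom hst (genW hs i) m =
      if (m : ZMod s) = (i - 1) * t - (levelShift s t : ℤ) then m + t
      else if (m : ZMod s) = i * t - (levelShift s t : ℤ) then m - t
      else m := by
  have h := levelIdx_spec hst m
  rw [levelHom_apply hst _ h]
  have h' := (ZMod.intCast_eq_intCast_iff _ _ s).2 h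
  push_cast at h'
  have hu : IsUnit (t : ZMod s) := (ZMod.isUnit_iff_coprime t s).2 hst.symm
  have key : ∀ j : ZMod s, ((levelIdx s t m : ℤ) : ZMod s) = j ↔
      (m : ZMod s) = j * t - (levelShift s t : ℤ) := by
    intro j
    rw [← hu.mul_left_inj, h']
    constructor <;> intro e <;> linear_combination e
  change m + t * (genWFun i (levelIdx s t m) - levelIdx s t m) = _
  simp only [genWFun, key]
  split_ifs <;> ring

theorem levelHom_periodic {s t : ℕ} (hst : s.Coprime t) (w : AffineSymm s) (m : ℤ) :
    levelHom hst w (m + s) = levelHom hst w m + s := by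
  have h := levelIdx_spec hst m
  have h' : levelIdx s t m * t ≡ (m + s) + levelShift s t [ZMOD s] := by
    refine h.trans ?_
    rw [Int.modEq_iff_dvd]
    exact ⟨1, by ring⟩
  rw [levelHom_apply hst w h, levelHom_apply hst w h']
  ring

theorem levelHom_symm {s t : ℕ} (hs : 2 ≤ s) (hst : s.Coprime t) (w : AffineHyp hs) (m : ℤ) :
    levelHom hst w.1 (-1 - m) = -1 - levelHom hst w.1 m := by
  have h := levelIdx_spec hst m
  have h' : (-1 - levelIdx s t m) * t ≡ (-1 - m) + levelShift s t [ZMOD s] := by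
    have h2 := two_mul_levelShift hst
    obtain ⟨k, hk⟩ := h.dvd
    rw [Int.modEq_iff_dvd]
    exact ⟨t - 1 - k, by linear_combination h2 - hk⟩
  rw [levelHom_apply hst w.1 h, levelHom_apply hst w.1 h', AffineHyp.symm]
  ring

theorem levelHom_le {s t : ℕ} (hs : 0 < s) (hst : s.Coprime t) (w : AffineSymm s) :
    ∃ D : ℤ, ∀ m, levelHom hst w m ≤ m + D := by
  refine ⟨∑ k ∈ Finset.range s, |levelHom hst w k - k|, fun m => ?_⟩
  have hs' : (0 : ℤ) < s := by exact_mod_cast hs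
  have h0 := Int.emod_nonneg m hs'.ne'
  have h1 := Int.emod_lt_of_pos m hs'
  have h2 := periodic_add_mul (levelHom_periodic hst w) (m % s) (m / s)
  rw [Int.emod_add_mul_ediv] at h2
  have h3 := Int.emod_add_mul_ediv m s
  have h4 := Finset.single_le_sum (f := fun k : ℕ => |levelHom hst w k - k|)
    (fun k _ => abs_nonneg _) (Finset.mem_range.2 (show (m % s).toNat < s by omega))
  simp only [Int.toNat_of_nonneg h0] at h4
  have h5 := le_abs_self (levelHom hst w (m % s) - m % s)
  linarith

/-! ### The level `t` actions of the affine hyperoctahedral group on self-conjugate cores -/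

theorem exists_levelAction {s t : ℕ} (hs : 2 ≤ s) (hst : s.Coprime t) (w : AffineHyp hs)
    (lam : SelfConjCore s) :
    ∃ mu : SelfConjCore s, betaSet mu.1 = levelHom hst w.1 '' betaSet lam.1 := by
  have hs0 : 0 < s := by omega
  have himg : ∀ x, x ∈ levelHom hst w.1 '' betaSet lam.1
      ↔ (levelHom hst w.1).symm x ∈ betaSet lam.1 := fun x => by
    rw [Equiv.image_eq_preimage_symm, Set.mem_preimage]
  have hsymm : ∀ x, (levelHom hst w.1).symm (-1 - x) = -1 - (levelHom hst w.1).symm x := by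
    intro x
    rw [Equiv.symm_apply_eq, levelHom_symm, Equiv.apply_symm_apply]
  have hper : ∀ x, (levelHom hst w.1).symm (x - s) = (levelHom hst w.1).symm x - s := by
    intro x
    have := levelHom_periodic hst w.1 ((levelHom hst w.1).symm x - s)
    rw [sub_add_cancel, Equiv.apply_symm_apply] at this
    rw [Equiv.symm_apply_eq]
    omega
  obtain ⟨mu, hmu⟩ := exists_betaSet_eq (levelHom hst w.1 '' betaSet lam.1)
    (fun x => by rw [himg, himg, hsymm]; exact lam.mem_symm _)
    (by
      obtain ⟨D, hD⟩ := levelHom_le hs0 hst w.1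
      obtain ⟨B, hB⟩ := betaSet_bddAbove lam.1
      refine ⟨B + D, ?_⟩
      rintro _ ⟨x, hx, rfl⟩
      have := hD x
      have := hB hx
      linarith)
  refine ⟨⟨mu, (isCore_iff hs0 _).2 ?_, (isSelfConjugate_iff _).2 ?_⟩, hmu⟩
  · intro b hb
    rw [hmu, himg] at hb ⊢
    rw [hper]
    exact lam.sub_mem hs0 _ hb
  · intro x
    rw [hmu, himg, himg, hsymm]
    exact lam.mem_symm _

/-- The image of a self-conjugate `s`-core `λ` under `w`: its beta-set is the image of the beta-set
of `λ` under the level `t` action of `w` on `ℤ`. -/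
noncomputable def levelSMul {s t : ℕ} (hs : 2 ≤ s) (hst : s.Coprime t) (w : AffineHyp hs)
    (lam : SelfConjCore s) : SelfConjCore s :=
  (exists_levelAction hs hst w lam).choose

theorem betaSet_levelSMul {s t : ℕ} (hs : 2 ≤ s) (hst : s.Coprime t) (w : AffineHyp hs)
    (lam : SelfConjCore s) :
    betaSet (levelSMul hs hst w lam).1 = levelHom hst w.1 '' betaSet lam.1 :=
  (exists_levelAction hs hst w lam).choose_spec

theorem one_levelSMul {s t : ℕ} (hs : 2 ≤ s) (hst : s.Coprime t) (lam : SelfConjCore s) :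
    levelSMul hs hst 1 lam = lam := by
  apply SelfConjCore.ext
  apply betaSet_injective
  rw [betaSet_levelSMul]
  simp

theorem mul_levelSMul {s t : ℕ} (hs : 2 ≤ s) (hst : s.Coprime t) (v w : AffineHyp hs)
    (lam : SelfConjCore s) :
    levelSMul hs hst (v * w) lam = levelSMul hs hst v (levelSMul hs hst w lam) := by
  apply SelfConjCore.ext
  apply betaSet_injective
  rw [betaSet_levelSMul, betaSet_levelSMul, betaSet_levelSMul, Set.image_image]
  simp

/-- The level `t` action of the affine hyperoctahedral group on the set of self-conjugate
`s`-cores. -/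
@[reducible]
noncomputable def levelAction {s t : ℕ} (hs : 2 ≤ s) (hst : s.Coprime t) :
    MulAction (AffineHyp hs) (SelfConjCore s) where
  smul := levelSMul hs hst
  one_smul := one_levelSMul hs hst
  mul_smul := mul_levelSMul hs hst

theorem sSet_levelSMul {s t : ℕ} (hs : 2 ≤ s) (hst : s.Coprime t) (w : AffineHyp hs)
    (lam : SelfConjCore s) (a : ℤ) :
    levelHom hst w.1 a ∈ sSet s (levelSMul hs hst w lam).1 ↔ a ∈ sSet s lam.1 := by
  have hs0 : 0 < s := by omega
  have e : levelHom hst w.1 a - s = levelHom hst w.1 (a - s) := by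
    have := levelHom_periodic hst w.1 (a - s)
    rw [sub_add_cancel] at this
    omega
  rw [SelfConjCore.mem_sSet_iff _ hs0, SelfConjCore.mem_sSet_iff _ hs0, betaSet_levelSMul, e,
    (levelHom hst w.1).injective.mem_set_image, (levelHom hst w.1).injective.mem_set_image]

theorem coreEquiv_levelSMul {s t : ℕ} (hs : 2 ≤ s) (hst : s.Coprime t) {N : ℕ}
    (w : AffineHyp hs) {lam mu : SelfConjCore s} (h : CoreEquiv s N lam.1 mu.1) :
    CoreEquiv s N (levelSMul hs hst w lam).1 (levelSMul hs hst w mu).1 := by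
  have hs0 : 0 < s := by omega
  rw [SelfConjCore.coreEquiv_iff hs0] at h ⊢
  intro a ha b hb hab
  obtain ⟨a, rfl⟩ := (levelHom hst w.1).surjective a
  obtain ⟨b, rfl⟩ := (levelHom hst w.1).surjective b
  rw [sSet_levelSMul] at ha hb
  refine periodic_modEq (levelHom_periodic hst w.1) (h a ha b hb ?_)
  have hinv := periodic_modEq (periodic_inv (levelHom_periodic hst w.1)) (N := 1)
    (show levelHom hst w.1 a ≡ levelHom hst w.1 b [ZMOD (1 * s)] by rwa [one_mul])
  simpa using hinv

/-- The image of a self-conjugate `s`-core `λ` of spread less than `N s` under `w`: the unique such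
core that is equivalent under `≡_N` to the image of `λ` under the level `t` action of `w` on
self-conjugate `s`-cores. -/
noncomputable def boundedLevelSMul {s t : ℕ} (hs : 2 ≤ s) (hst : s.Coprime t) {N : ℕ}
    (hN : 0 < N) (w : AffineHyp hs) (lam : BoundedSelfConjCore s N) : BoundedSelfConjCore s N :=
  (SelfConjCore.exists_bounded (Nat.zero_lt_of_lt hs) hN (levelSMul hs hst w lam.1)).choose

theorem coreEquiv_boundedLevelSMul {s t : ℕ} (hs : 2 ≤ s) (hst : s.Coprime t) {N : ℕ}
    (hN : 0 < N) (w : AffineHyp hs) (lam : BoundedSelfConjCore s N) :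
    CoreEquiv s N (levelSMul hs hst w lam.1).1 (boundedLevelSMul hs hst hN w lam).1.1 :=
  (SelfConjCore.exists_bounded (Nat.zero_lt_of_lt hs) hN (levelSMul hs hst w lam.1)).choose_spec

theorem eq_boundedLevelSMul {s t : ℕ} (hs : 2 ≤ s) (hst : s.Coprime t) {N : ℕ}
    (hN : 0 < N) (w : AffineHyp hs) (lam mu : BoundedSelfConjCore s N)
    (h : CoreEquiv s N (levelSMul hs hst w lam.1).1 mu.1.1) :
    boundedLevelSMul hs hst hN w lam = mu := by
  have hs0 : 0 < s := by omega
  apply BoundedSelfConjCore.ext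
  refine SelfConjCore.eq_of_coreEquiv hs0 (boundedLevelSMul hs hst hN w lam).2 mu.2 ?_
  exact SelfConjCore.coreEquiv_trans hs0
    (SelfConjCore.coreEquiv_symm hs0 (coreEquiv_boundedLevelSMul hs hst hN w lam)) h

/-- The level `t` action of the affine hyperoctahedral group on the set of self-conjugate
`s`-cores of spread less than `N s`. -/
@[reducible]
noncomputable def boundedLevelAction {s t : ℕ} (hs : 2 ≤ s) (hst : s.Coprime t) {N : ℕ}
    (hN : 0 < N) : MulAction (AffineHyp hs) (BoundedSelfConjCore s N) where
  smul := boundedLevelSMul hs hst hN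
  one_smul lam := by
    refine eq_boundedLevelSMul hs hst hN 1 lam lam ?_
    rw [one_levelSMul]
    exact ⟨Equiv.refl _, fun _ => Int.ModEq.refl _⟩
  mul_smul v w lam := by
    refine eq_boundedLevelSMul hs hst hN (v * w) lam
      (boundedLevelSMul hs hst hN v (boundedLevelSMul hs hst hN w lam)) ?_
    rw [mul_levelSMul]
    exact SelfConjCore.coreEquiv_trans (Nat.zero_lt_of_lt hs)
      (coreEquiv_levelSMul hs hst v (coreEquiv_boundedLevelSMul hs hst hN w lam))
      (coreEquiv_boundedLevelSMul hs hst hN v _)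

theorem mul_pos_of_coprime {s t n : ℕ} (hs : 2 ≤ s) (hst : s.Coprime t) (hn : 1 ≤ n) :
    0 < n * t := by
  refine Nat.mul_pos hn (Nat.pos_of_ne_zero ?_)
  rintro rfl
  rw [Nat.coprime_zero_right] at hst
  omega

/-- The stabiliser of a self-conjugate `s`-core under the level `t` action of the affine
hyperoctahedral group on the set of all self-conjugate `s`-cores. -/
noncomputable def stabSC {s t : ℕ} (hs : 2 ≤ s) (hst : s.Coprime t) (lam : SelfConjCore s) :
    Subgroup (AffineHyp hs) :=
  letI := levelAction hs hst
  MulAction.stabilizer (AffineHyp hs) lam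

/-- The orbit of a core under the level `t` action of the affine hyperoctahedral group on the
finite set of self-conjugate `s`-cores of spread less than `N s`. -/
noncomputable def levelOrbit {s t : ℕ} (hs : 2 ≤ s) (hst : s.Coprime t) {N : ℕ} (hN : 0 < N)
    (lam : BoundedSelfConjCore s N) : Set (BoundedSelfConjCore s N) :=
  letI := boundedLevelAction hs hst hN
  MulAction.orbit (AffineHyp hs) lam

end SCCore

namespace SCCore

/-! ### Elements of the affine hyperoctahedral group with prescribed values -/

/-! Write `u = s / 2`. An element of the affine hyperoctahedral group commutes with `m ↦ m + s` and
with `m ↦ -1 - m`, so it is determined by its window, the values at `0, …, u - 1`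
(`AffineHyp.ext_half`). Conversely, any `u` integers that together with their mirror images `-1 - x`
are pairwise incongruent modulo `s` form a window (`exists_affineHyp`): as long as the window is not
`0, …, u - 1`, some generator brings it strictly closer in squared distance.

Let `K` be the normal subgroup of elements congruent to the identity modulo `n s`. Its cosets
correspond to windows modulo `n s`, that is, to a permutation of `u` letters, `u` signs and `u`
shifts modulo `n`; hence `K` has index `(2 n) ^ u * u!` (`index_congruenceSubgroup`).

At level `t`, a displacement by `n s k` becomes a displacement by `n t s k`, so `K` preserves every
`≡_{nt}` class of cores. It acts on each class simply transitively. Freeness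
(`eq_one_of_levelSMul_eq`): an element of `K` fixing a core fixes its `s`-set pointwise, because the
`s`-set has one element per class modulo `s`. Transitivity (`exists_levelSMul_eq`): the differences
between two equivalent `s`-sets are multiples of `n t s`, and self-conjugacy makes them
antisymmetric, so they come from a window.

Hence the stabiliser of a core in the bounded action is the product of `stabSC` and `K`, which meet
trivially (`boundedStab_eq_sup`). The index of `K` in this product is therefore the order of
`stabSC`, and multiplicativity of the index with the orbit-stabiliser theorem gives the count
(`card_stabSC_mul_index`). -/

theorem genWFun_of_lt {s i : ℕ} (hi : 1 ≤ i) (his : i < s) {m : ℤ} (h0 : 0 ≤ m) (hm : m < s) :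
    genWFun (i : ZMod s) m = if m = i - 1 then m + 1 else if m = i then m - 1 else m := by
  have key : ∀ j : ℤ, 0 ≤ j → j < s → ((m : ZMod s) = (j : ZMod s) ↔ m = j) := by
    intro j hj hjs
    rw [ZMod.intCast_eq_intCast_iff, Int.ModEq, Int.emod_eq_of_lt h0 hm, Int.emod_eq_of_lt hj hjs]
  have k1 := key (i - 1) (by omega) (by omega)
  have k2 := key i (by omega) (by omega)
  push_cast at k1 k2
  simp only [genWFun, k1, k2]

theorem genWFun_zero_of_lt {s : ℕ} {m : ℤ} (h0 : 0 ≤ m) (hm : m + 1 < s) :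
    genWFun (0 : ZMod s) m = if m = 0 then -1 else m := by
  have k1 : (m : ZMod s) ≠ 0 - 1 := by
    intro h
    have : ((m + 1 : ℤ) : ZMod s) = 0 := by push_cast; rw [h]; ring
    rw [ZMod.intCast_zmod_eq_zero_iff_dvd] at this
    have := Int.le_of_dvd (by omega) this
    omega
  have k2 : (m : ZMod s) = 0 ↔ m = 0 := by
    rw [ZMod.intCast_zmod_eq_zero_iff_dvd]
    exact ⟨fun h => Int.eq_zero_of_dvd_of_nonneg_of_lt h0 (by omega) h, fun h => h ▸ dvd_zero _⟩
  simp only [genWFun, k1, k2, if_false]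
  split_ifs with h <;> omega

/-- With the next two evaluations, this shows how the generators act on windows by precomposition:
`v_0` reflects the first entry, `v_i` for `0 < i < u` swaps two neighbours, and `v_u` reflects the
last entry about `(s - 1) / 2`. -/
theorem genV_zero_apply {s : ℕ} (hs : 2 ≤ s) {j : ℕ} (hj : j < s / 2) :
    (genV hs 0 : Equiv.Perm ℤ) j = if j = 0 then -1 else (j : ℤ) := by
  have h := genWFun_zero_of_lt (s := s) (m := j) (by omega) (by omega)
  simp only [Nat.cast_eq_zero] at h
  rw [← h, genV, if_pos rfl]
  rfl

theorem natCast_zmod_eq_iff {s i j : ℕ} (hi : i < s) (hj : j < s) :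
    (i : ZMod s) = (j : ZMod s) ↔ i = j := by
  rw [ZMod.natCast_eq_natCast_iff, Nat.ModEq, Nat.mod_eq_of_lt hi, Nat.mod_eq_of_lt hj]

theorem neg_natCast_zmod {s i : ℕ} (hi : i ≤ s) : -(i : ZMod s) = ((s - i : ℕ) : ZMod s) := by
  rw [Nat.cast_sub hi]
  simp

theorem genV_apply_of_lt {s : ℕ} (hs : 2 ≤ s) {i j : ℕ} (hi : 1 ≤ i) (hi' : i < s / 2)
    (hj : j < s / 2) :
    (genV hs (i : ZMod s) : Equiv.Perm ℤ) j = (Equiv.swap (i - 1) i j : ℕ) := by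
  have h0 : (i : ZMod s) ≠ 0 := by
    intro h
    have := (natCast_zmod_eq_iff (s := s) (i := i) (j := 0) (by omega) (by omega)).1
      (by simpa using h)
    omega
  have h1 : (i : ZMod s) ≠ ((s / 2 : ℕ) : ZMod s) := by
    rw [Ne, natCast_zmod_eq_iff (by omega) (by omega)]
    omega
  have h2 : (i : ZMod s) ≠ -((s / 2 : ℕ) : ZMod s) := by
    rw [neg_natCast_zmod (by omega), Ne, natCast_zmod_eq_iff (by omega) (by omega)]
    omega
  rw [genV, if_neg h0, if_neg (by tauto)]
  change genWFun (i : ZMod s) (genWFun (-(i : ZMod s)) j) = _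
  rw [neg_natCast_zmod (by omega),
    genWFun_of_lt (m := j) (by omega) (by omega) (by omega) (by omega),
    if_neg (by omega), if_neg (by omega),
    genWFun_of_lt (by omega) (by omega) (by omega) (by omega), Equiv.swap_apply_def]
  split_ifs <;> omega

theorem genV_half_apply {s : ℕ} (hs : 2 ≤ s) {j : ℕ} (hj : j < s / 2) :
    (genV hs ((s / 2 : ℕ) : ZMod s) : Equiv.Perm ℤ) j
      = if j = s / 2 - 1 then (s : ℤ) - 1 - j else j := by
  have h0 : ((s / 2 : ℕ) : ZMod s) ≠ 0 := by
    intro h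
    have := (natCast_zmod_eq_iff (s := s) (i := s / 2) (j := 0) (by omega) (by omega)).1
      (by simpa using h)
    omega
  rw [genV, if_neg h0, if_pos (Or.inl rfl)]
  change genWFun ((s / 2 : ℕ) : ZMod s) (genWFun (-((s / 2 : ℕ) : ZMod s))
    (genWFun ((s / 2 : ℕ) : ZMod s) j)) = _
  rw [neg_natCast_zmod (by omega),
    genWFun_of_lt (m := j) (by omega) (by omega) (by omega) (by omega)]
  by_cases h : j = s / 2 - 1
  · rw [if_pos h, if_pos (by omega),
      genWFun_of_lt (m := (j : ℤ) + 1) (by omega) (by omega) (by omega) (by omega)]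
    -- For even `s` the classes of `u` and `-u` coincide and the three factors carry `u - 1` to `u`,
    -- `u - 1`, `u`. For odd `s` they carry it to `u`, `u + 1`, `u + 1`. Both end at `s - 1 - j`.
    by_cases he : s / 2 = s - s / 2
    · rw [if_neg (by omega), if_pos (by omega),
        genWFun_of_lt (by omega) (by omega) (by omega) (by omega), if_pos (by omega)]
      omega
    · rw [if_pos (by omega),
        genWFun_of_lt (by omega) (by omega) (by omega) (by omega), if_neg (by omega),
        if_neg (by omega)]
      omega
  · rw [if_neg h, if_neg (by omega), if_neg (by omega),
      genWFun_of_lt (m := (j : ℤ)) (by omega) (by omega) (by omega) (by omega),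
      if_neg (by omega), if_neg (by omega),
      genWFun_of_lt (m := (j : ℤ)) (by omega) (by omega) (by omega) (by omega),
      if_neg (by omega), if_neg (by omega)]

/-! ### Windows, and the descent that sorts them -/

/-- The values `f i` for `i < s / 2` and their negatives `-1 - f i` are pairwise incongruent
modulo `s`. -/
def IsWindow (s : ℕ) (f : ℕ → ℤ) : Prop :=
  ∀ i < s / 2, ∀ j < s / 2, (i ≠ j → ¬ f i ≡ f j [ZMOD s]) ∧ ¬ f i ≡ -1 - f j [ZMOD s]

/-- The generator `v_i`, as an element of the affine hyperoctahedral group. -/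
def hypV {s : ℕ} (hs : 2 ≤ s) (i : ZMod s) : AffineHyp hs :=
  ⟨genV hs i, Subgroup.subset_closure ⟨i, rfl⟩⟩

theorem AffineHyp.reflect {s : ℕ} {hs : 2 ≤ s} (w : AffineHyp hs) (m : ℤ) :
    (w.1 : Equiv.Perm ℤ) (s - 1 - m) = s - 1 - (w.1 : Equiv.Perm ℤ) m := by
  rw [show (s : ℤ) - 1 - m = -1 - m + s by ring, AffineSymm.periodic, AffineHyp.symm]
  ring

/-- The end of the descent, when no generator improves the window. Incongruence upgrades
monotonicity to strict monotonicity, and `u` strictly increasing integers between `0` and `u - 1`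
leave no freedom: induction from the left bounds `f i` below by `i`, induction from the right bounds
it above. -/
theorem window_eq_id {s : ℕ} {f : ℕ → ℤ} (hf : IsWindow s f) (h0 : 0 ≤ f 0)
    (hmono : ∀ i, 1 ≤ i → i < s / 2 → f (i - 1) ≤ f i) (hu : f (s / 2 - 1) ≤ (s / 2 - 1 : ℕ)) :
    ∀ i < s / 2, f i = i := by
  have hlt : ∀ i, i + 1 < s / 2 → f i < f (i + 1) := by
    intro i hi
    have h1 := hmono (i + 1) (by omega) hi
    rw [Nat.add_sub_cancel] at h1
    refine lt_of_le_of_ne h1 fun h => ?_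
    exact (hf i (by omega) (i + 1) hi).1 (by omega) (h ▸ Int.ModEq.refl _)
  have hlow : ∀ i < s / 2, (i : ℤ) ≤ f i := by
    intro i
    induction i with
    | zero => intro _; simpa using h0
    | succ i ih =>
      intro hi
      have := ih (by omega)
      have := hlt i hi
      push_cast
      omega
  have hupp : ∀ k < s / 2, f (s / 2 - 1 - k) ≤ (s / 2 - 1 - k : ℕ) := by
    intro k
    induction k with
    | zero => intro _; exact hu
    | succ k ih =>
      intro hk
      have h1 := ih (by omega)
      have h2 := hlt (s / 2 - 1 - (k + 1)) (by omega)
      rw [show s / 2 - 1 - (k + 1) + 1 = s / 2 - 1 - k by omega] at h2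
      omega
  intro i hi
  have h1 := hupp (s / 2 - 1 - i) (by omega)
  rw [show s / 2 - 1 - (s / 2 - 1 - i) = i by omega] at h1
  exact le_antisymm h1 (hlow i hi)

theorem isWindow_swap {s : ℕ} {f : ℕ → ℤ} (hf : IsWindow s f) {a b : ℕ} (ha : a < s / 2)
    (hb : b < s / 2) : IsWindow s fun j => f (Equiv.swap a b j) := by
  have hlt : ∀ j < s / 2, Equiv.swap a b j < s / 2 := by
    intro j hj
    rw [Equiv.swap_apply_def]
    split_ifs <;> assumption
  intro i hi j hj
  have := hf _ (hlt i hi) _ (hlt j hj)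
  exact ⟨fun h => this.1 ((Equiv.swap a b).injective.ne h), this.2⟩

/-- The window condition concerns the classes of `f i` and `-1 - f i` symmetrically, so exchanging
the two for a single index preserves it. Stated up to congruence, it covers the reflections `-1 - x`
and `s - 1 - x` at once. -/
theorem isWindow_update {s : ℕ} {f : ℕ → ℤ} (hf : IsWindow s f) {a : ℕ} (ha : a < s / 2)
    {x : ℤ} (hx : x ≡ -1 - f a [ZMOD s]) : IsWindow s (Function.update f a x) := by
  have hx' : -1 - x ≡ f a [ZMOD s] := by
    have := (Int.ModEq.refl (n := s) (-1)).sub hx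
    rwa [sub_sub_cancel] at this
  have neg : ∀ {y z : ℤ}, y ≡ -1 - z [ZMOD s] → -1 - y ≡ z [ZMOD s] := by
    intro y z h
    have := (Int.ModEq.refl (n := s) (-1)).sub h
    rwa [sub_sub_cancel] at this
  intro i hi j hj
  rcases eq_or_ne i a with hia | hia <;> rcases eq_or_ne j a with hja | hja
  · subst hia hja
    refine ⟨fun h => (h rfl).elim, ?_⟩
    rw [Function.update_self]
    intro h
    exact (hf j hi j hi).2 ((hx'.symm.trans (h.symm.trans hx)))
  · subst hia
    rw [Function.update_self, Function.update_of_ne hja]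
    refine ⟨fun _ h => (hf j hj i hi).2 (h.symm.trans hx), fun h => ?_⟩
    exact (hf i hi j hj).1 hja.symm (hx'.symm.trans (neg h))
  · subst hja
    rw [Function.update_self, Function.update_of_ne hia]
    refine ⟨fun _ h => (hf i hi j hj).2 (h.trans hx), fun h => ?_⟩
    exact (hf i hi j hj).1 hia (h.trans hx')
  · rw [Function.update_of_ne hia, Function.update_of_ne hja]
    exact hf i hi j hj

theorem sum_sq_update_lt {u a : ℕ} (ha : a < u) (f : ℕ → ℤ) {x : ℤ}
    (hx : (x - a) ^ 2 < (f a - a) ^ 2) :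
    ∑ i ∈ Finset.range u, (Function.update f a x i - i) ^ 2
      < ∑ i ∈ Finset.range u, (f i - i) ^ 2 := by
  refine Finset.sum_lt_sum (fun i _ => ?_) ⟨a, Finset.mem_range.2 ha, by simpa using hx⟩
  rcases eq_or_ne i a with rfl | h
  · simpa using hx.le
  · rw [Function.update_of_ne h]

/-- The rearrangement inequality for one inversion: undoing it lowers the sum by `2 (b - a) (f a - f
b)`. -/
theorem sum_sq_swap_lt {u a b : ℕ} (ha : a < u) (hb : b < u) (hab : a < b) (f : ℕ → ℤ)
    (hf : f b < f a) :
    ∑ i ∈ Finset.range u, (f (Equiv.swap a b i) - i) ^ 2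
      < ∑ i ∈ Finset.range u, (f i - i) ^ 2 := by
  rw [← sub_neg, ← Finset.sum_sub_distrib,
    Finset.sum_eq_add_of_mem a b (Finset.mem_range.2 ha) (Finset.mem_range.2 hb) hab.ne
      (fun c _ hc => by rw [Equiv.swap_apply_of_ne_of_ne hc.1 hc.2, sub_self]),
    Equiv.swap_apply_left, Equiv.swap_apply_right]
  have h1 : (a : ℤ) < b := by exact_mod_cast hab
  nlinarith [mul_pos (sub_pos.2 h1) (sub_pos.2 hf)]

/-- Every window is the window of an element of the affine hyperoctahedral group. -/
theorem exists_affineHyp {s : ℕ} (hs : 2 ≤ s) (f : ℕ → ℤ) (hf : IsWindow s f) :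
    ∃ w : AffineHyp hs, ∀ i < s / 2, (w.1 : Equiv.Perm ℤ) i = f i := by
  obtain ⟨d, hd⟩ : ∃ d : ℕ, (∑ i ∈ Finset.range (s / 2), (f i - i) ^ 2).toNat = d := ⟨_, rfl⟩
  -- Descent on the squared distance of the window from `0, …, u - 1`. The three cases correspond to
  -- the three kinds of generators; each `v` is applied first, so that `w * v` has window `f` once
  -- `w` has the improved one.
  induction d using Nat.strong_induction_on generalizing f with
  | _ d ih =>
    have step : ∀ g : ℕ → ℤ, IsWindow s g →
        ∑ i ∈ Finset.range (s / 2), (g i - i) ^ 2 < ∑ i ∈ Finset.range (s / 2), (f i - i) ^ 2 →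
        ∃ w : AffineHyp hs, ∀ i < s / 2, (w.1 : Equiv.Perm ℤ) i = g i := by
      intro g hg hlt
      refine ih _ ?_ g hg rfl
      have : 0 ≤ ∑ i ∈ Finset.range (s / 2), (g i - i) ^ 2 :=
        Finset.sum_nonneg fun i _ => sq_nonneg _
      omega
    by_cases h0 : f 0 < 0
    · obtain ⟨w, hw⟩ := step (Function.update f 0 (-1 - f 0))
        (isWindow_update hf (by omega) (Int.ModEq.refl _))
        (sum_sq_update_lt (by omega) f (by push_cast; nlinarith))
      refine ⟨w * hypV hs 0, fun i hi => ?_⟩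
      change (w.1 : Equiv.Perm ℤ) ((genV hs 0 : Equiv.Perm ℤ) i) = f i
      rw [genV_zero_apply hs hi]
      split_ifs with h
      · have h1 := hw i hi
        rw [h, Function.update_self] at h1
        have h2 := AffineHyp.symm w 0
        rw [Nat.cast_zero] at h1
        rw [h, show (-1 : ℤ) = -1 - 0 by ring, h2, h1]
        ring
      · rw [hw i hi, Function.update_of_ne h]
    by_cases hu : ((s / 2 - 1 : ℕ) : ℤ) < f (s / 2 - 1)
    -- For odd `s` the reflection fixes `(s - 1) / 2 = u`, and the distance would not drop there.
    -- The window condition excludes this value, its class being its own mirror image.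
    · have hne : f (s / 2 - 1) ≠ s - 1 - f (s / 2 - 1) := by
        intro h
        refine (hf (s / 2 - 1) (by omega) (s / 2 - 1) (by omega)).2 ?_
        rw [Int.modEq_iff_dvd]
        exact ⟨-1, by linarith⟩
      obtain ⟨w, hw⟩ := step (Function.update f (s / 2 - 1) (s - 1 - f (s / 2 - 1)))
        (isWindow_update hf (by omega) (by rw [Int.modEq_iff_dvd]; exact ⟨-1, by ring⟩))
        (sum_sq_update_lt (by omega) f (by
          rw [sq_lt_sq, abs_of_pos (sub_pos.2 hu), abs_lt]
          constructor <;> omega))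
      refine ⟨w * hypV hs ((s / 2 : ℕ) : ZMod s), fun i hi => ?_⟩
      change (w.1 : Equiv.Perm ℤ) ((genV hs ((s / 2 : ℕ) : ZMod s) : Equiv.Perm ℤ) i) = f i
      rw [genV_half_apply hs hi]
      split_ifs with h
      · rw [AffineHyp.reflect, hw i hi, h, Function.update_self]
        ring
      · rw [hw i hi, Function.update_of_ne h]
    by_cases hm : ∃ i, 1 ≤ i ∧ i < s / 2 ∧ f i < f (i - 1)
    · obtain ⟨a, ha, hau, hlt⟩ := hm
      obtain ⟨w, hw⟩ := step _ (isWindow_swap hf (a := a - 1) (b := a) (by omega) hau)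
        (sum_sq_swap_lt (by omega) hau (by omega) f hlt)
      refine ⟨w * hypV hs (a : ZMod s), fun i hi => ?_⟩
      change (w.1 : Equiv.Perm ℤ) ((genV hs (a : ZMod s) : Equiv.Perm ℤ) i) = f i
      rw [genV_apply_of_lt hs ha hau hi, hw, Equiv.swap_apply_self]
      rw [Equiv.swap_apply_def]
      split_ifs <;> omega
    · push Not at hm
      have := window_eq_id hf (by omega) hm (by omega)
      exact ⟨1, fun i hi => (this i hi).symm⟩

/-- Periodic functions that respect `m ↦ -1 - m` are determined by their values on
`0, …, s / 2 - 1`. -/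
theorem eq_of_eq_on_half {s : ℕ} (hs : 2 ≤ s) {v w : ℤ → ℤ} (hv : ∀ m, v (m + s) = v m + s)
    (hw : ∀ m, w (m + s) = w m + s) (hv' : ∀ m, v (-1 - m) = -1 - v m)
    (hw' : ∀ m, w (-1 - m) = -1 - w m) (h : ∀ i : ℕ, i < s / 2 → v i = w i) (m : ℤ) :
    v m = w m := by
  have key : ∀ r : ℤ, 0 ≤ r → r < s → v r = w r := by
    intro r hr hrs
    have e : -1 - ((s : ℤ) - 1 - r) + s = r := by ring
    have h1 := hv (-1 - ((s : ℤ) - 1 - r))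
    have h2 := hw (-1 - ((s : ℤ) - 1 - r))
    rw [hv', e] at h1
    rw [hw', e] at h2
    by_cases c : r < s / 2
    · have := h r.toNat (by omega)
      rwa [Int.toNat_of_nonneg hr] at this
    by_cases c' : (s : ℤ) - 1 - r < s / 2
    · have := h ((s : ℤ) - 1 - r).toNat (by omega)
      rw [Int.toNat_of_nonneg (by omega)] at this
      omega
    -- The centre of the period, present only for odd `s`: the reflection forces both values to be
    -- `(s - 1) / 2`.
    · have : (s : ℤ) - 1 - r = r := by omega
      rw [this] at h1 h2
      omega
  have h1 := periodic_add_mul hv (m % s) (m / s)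
  have h2 := periodic_add_mul hw (m % s) (m / s)
  rw [Int.emod_add_mul_ediv] at h1 h2
  rw [h1, h2, key _ (Int.emod_nonneg _ (by omega)) (Int.emod_lt_of_pos _ (by omega))]

/-! ### The congruence subgroup of the affine hyperoctahedral group -/

theorem AffineHyp.ext_half {s : ℕ} {hs : 2 ≤ s} {v w : AffineHyp hs}
    (h : ∀ i : ℕ, i < s / 2 → (v.1 : Equiv.Perm ℤ) i = (w.1 : Equiv.Perm ℤ) i) : v = w := by
  apply Subtype.ext
  apply Subtype.ext
  exact Equiv.ext (eq_of_eq_on_half hs (AffineSymm.periodic _) (AffineSymm.periodic _)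
    (AffineHyp.symm v) (AffineHyp.symm w) h)

/-- The elements of the affine hyperoctahedral group that fix every integer modulo `n s`. -/
def congruenceSubgroup {s : ℕ} (hs : 2 ≤ s) (n : ℕ) : Subgroup (AffineHyp hs) where
  carrier := {w | ∀ m : ℤ, (w.1 : Equiv.Perm ℤ) m ≡ m [ZMOD (n * s)]}
  one_mem' := fun m => Int.ModEq.refl _
  mul_mem' := fun {v w} hv hw m => (hv ((w.1 : Equiv.Perm ℤ) m)).trans (hw m)
  inv_mem' := fun {w} hw m => by
    have := hw ((w.1 : Equiv.Perm ℤ)⁻¹ m)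
    simpa using this.symm

/-- Periodic maps preserve congruence modulo `n s`. Normality is what permits the second isomorphism
argument in `card_stabSC_mul_index`. -/
instance congruenceSubgroup_normal {s : ℕ} (hs : 2 ≤ s) (n : ℕ) :
    (congruenceSubgroup hs n).Normal where
  conj_mem w hw g m := by
    have := periodic_modEq (AffineSymm.periodic g.1) (hw ((g.1 : Equiv.Perm ℤ)⁻¹ m))
    simpa using this

/-- An element congruent to the identity modulo `n s` on the first half of a period lies in the
congruence subgroup. -/
theorem mem_congruenceSubgroup_of_half {s : ℕ} {hs : 2 ≤ s} {n : ℕ} {w : AffineHyp hs}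
    (h : ∀ i : ℕ, i < s / 2 → (w.1 : Equiv.Perm ℤ) i ≡ i [ZMOD (n * s)]) :
    w ∈ congruenceSubgroup hs n := by
  intro m
  have key : ∀ r : ℤ, 0 ≤ r → r < s → (w.1 : Equiv.Perm ℤ) r ≡ r [ZMOD (n * s)] := by
    intro r hr hrs
    have h1 := AffineHyp.reflect w r
    by_cases c : r < s / 2
    · have := h r.toNat (by omega)
      rwa [Int.toNat_of_nonneg hr] at this
    by_cases c' : (s : ℤ) - 1 - r < s / 2
    · have h2 := h ((s : ℤ) - 1 - r).toNat (by omega)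
      rw [Int.toNat_of_nonneg (by omega), h1] at h2
      have h3 := (Int.ModEq.refl ((s : ℤ) - 1)).sub h2
      rwa [sub_sub_cancel, sub_sub_cancel] at h3
    · have e : (s : ℤ) - 1 - r = r := by omega
      rw [e] at h1
      rw [show (w.1 : Equiv.Perm ℤ) r = r by omega]
  have h1 := periodic_add_mul (AffineSymm.periodic w.1) (m % s) (m / s)
  have h2 := (key _ (Int.emod_nonneg m (by omega)) (Int.emod_lt_of_pos m (by omega))).add_right
    (s * (m / s))
  rw [Int.emod_add_mul_ediv] at h1 h2
  rwa [h1]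

/-- Identifies left cosets of the congruence subgroup with windows modulo `n s`; `v` and its inverse
both preserve congruence modulo `n s`. -/
theorem inv_mul_mem_congruenceSubgroup {s : ℕ} {hs : 2 ≤ s} {n : ℕ} {v w : AffineHyp hs} :
    v⁻¹ * w ∈ congruenceSubgroup hs n ↔ ∀ i : ℕ, i < s / 2 →
      (v.1 : Equiv.Perm ℤ) i ≡ (w.1 : Equiv.Perm ℤ) i [ZMOD (n * s)] := by
  constructor
  · intro h i _
    have := periodic_modEq (AffineSymm.periodic v.1) (h i)
    simpa using this.symm
  · intro h
    apply mem_congruenceSubgroup_of_half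
    intro i hi
    have := periodic_modEq (periodic_inv (AffineSymm.periodic v.1)) (h i hi)
    simpa using this.symm

/-! ### Counting the cosets of the congruence subgroup -/

/-- The integer `r` if `b` is true, and its mirror image `s - 1 - r` otherwise. -/
def mirror (s : ℕ) (b : Bool) (r : ℤ) : ℤ := if b then r else s - 1 - r

theorem mirror_mem {s r : ℕ} (hr : r < s / 2) (b : Bool) : 0 ≤ mirror s b r ∧ mirror s b r < s := by
  unfold mirror
  split_ifs <;> omega

theorem mirror_inj {s r r' : ℕ} (hr : r < s / 2) (hr' : r' < s / 2) {b b' : Bool}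
    (h : mirror s b r = mirror s b' r') : b = b' ∧ r = r' := by
  unfold mirror at h
  cases b <;> cases b' <;> simp at h ⊢ <;> omega

theorem eq_of_modEq_of_mem {s : ℕ} {x y : ℤ} (hx : 0 ≤ x ∧ x < s) (hy : 0 ≤ y ∧ y < s)
    (h : x ≡ y [ZMOD s]) : x = y := by
  rwa [Int.ModEq, Int.emod_eq_of_lt hx.1 hx.2, Int.emod_eq_of_lt hy.1 hy.2] at h

/-- A residue, outside the class fixed by `m ↦ s - 1 - m`, is `r` or `s - 1 - r` with
`r < s / 2`. -/
theorem exists_mirror {s : ℕ} (hs : 0 < s) {m : ℤ} (hm : ¬ m ≡ -1 - m [ZMOD s]) :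
    ∃ (r : Fin (s / 2)) (b : Bool), m % s = mirror s b r := by
  have h0 := Int.emod_nonneg m (show (s : ℤ) ≠ 0 by omega)
  have h1 := Int.emod_lt_of_pos m (show (0 : ℤ) < s by omega)
  by_cases c : m % s < s / 2
  · exact ⟨⟨(m % s).toNat, by omega⟩, true, by simp [mirror, h0]⟩
  by_cases c' : (s : ℤ) - 1 - m % s < s / 2
  · refine ⟨⟨((s : ℤ) - 1 - m % s).toNat, by omega⟩, false, ?_⟩
    simp only [mirror, Bool.false_eq_true, if_false]
    omega
  · refine (hm ?_).elim
    have h2 := Int.emod_add_mul_ediv m s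
    rw [Int.modEq_iff_dvd]
    refine ⟨-1 - 2 * (m / s), ?_⟩
    have : (s : ℤ) - 1 - m % s = m % s := by omega
    linear_combination this + 2 * h2

theorem isWindow_mirror {s : ℕ} (σ : ℕ → ℕ) (hσ : ∀ i < s / 2, σ i < s / 2)
    (hinj : ∀ i < s / 2, ∀ j < s / 2, σ i = σ j → i = j) (b : ℕ → Bool) (k : ℕ → ℤ) :
    IsWindow s fun i => mirror s (b i) (σ i) + s * k i := by
  have hmod : ∀ i, mirror s (b i) (σ i) + s * k i ≡ mirror s (b i) (σ i) [ZMOD s] := fun i => by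
    simp [Int.ModEq]
  intro i hi j hj
  constructor
  · intro hij h
    have := eq_of_modEq_of_mem (mirror_mem (hσ i hi) (b i)) (mirror_mem (hσ j hj) (b j))
      ((hmod i).symm.trans (h.trans (hmod j)))
    exact hij (hinj i hi j hj (mirror_inj (hσ i hi) (hσ j hj) this).2)
  · intro h
    -- Reflection flips the sign and keeps the letter, so a collision with a mirror image would
    -- force `i = j` and then `b j = !b j`.
    have h1 : -1 - (mirror s (b j) (σ j) + s * k j) ≡ mirror s (!b j) (σ j) [ZMOD s] := by
      rw [Int.modEq_iff_dvd]
      refine ⟨1 + k j, ?_⟩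
      cases b j <;> simp [mirror] <;> ring
    have := eq_of_modEq_of_mem (mirror_mem (hσ i hi) (b i)) (mirror_mem (hσ j hj) (!b j))
      ((hmod i).symm.trans (h.trans h1))
    obtain ⟨hb, hij⟩ := mirror_inj (hσ i hi) (hσ j hj) this
    rw [hinj i hi j hj hij] at hb
    cases hbj : b j <;> simp [hbj] at hb

theorem AffineHyp.isWindow {s : ℕ} {hs : 2 ≤ s} (w : AffineHyp hs) :
    IsWindow s fun i => (w.1 : Equiv.Perm ℤ) i := by
  have hinv : ∀ {x y : ℤ}, (w.1 : Equiv.Perm ℤ) x ≡ (w.1 : Equiv.Perm ℤ) y [ZMOD s] →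
      x ≡ y [ZMOD s] := by
    intro x y h
    have := periodic_modEq (periodic_inv (AffineSymm.periodic w.1)) (N := 1)
      (m := (w.1 : Equiv.Perm ℤ) x) (m' := (w.1 : Equiv.Perm ℤ) y) (by rwa [one_mul])
    simpa using this
  intro i hi j hj
  constructor
  · intro hij h
    have := eq_of_modEq_of_mem (by omega) (by omega) (hinv h)
    omega
  · intro h
    rw [← AffineHyp.symm] at h
    have h1 := hinv h
    have h2 : (i : ℤ) ≡ s - 1 - j [ZMOD s] := h1.trans (by
      rw [Int.modEq_iff_dvd]
      exact ⟨1, by ring⟩)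
    have := eq_of_modEq_of_mem (by omega) (by omega) h2
    omega

/-- Signed permutations of `Fin u` with shifts modulo `n`. -/
abbrev WindowData (u n : ℕ) : Type := Equiv.Perm (Fin u) × (Fin u → Bool × Fin n)

theorem exists_affineHyp_of_data {s : ℕ} (hs : 2 ≤ s) {n : ℕ} (d : WindowData (s / 2) n) :
    ∃ w : AffineHyp hs, ∀ i : Fin (s / 2),
      (w.1 : Equiv.Perm ℤ) (i : ℕ) = mirror s (d.2 i).1 (d.1 i : ℕ) + s * ((d.2 i).2 : ℕ) := by
  obtain ⟨w, hw⟩ := exists_affineHyp hs _ (isWindow_mirror (s := s)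
    (fun i => if h : i < s / 2 then (d.1 ⟨i, h⟩ : ℕ) else 0)
    (fun i hi => by simp only [dif_pos hi]; exact (d.1 ⟨i, hi⟩).2)
    (fun i hi j hj h => by
      simp only [dif_pos hi, dif_pos hj] at h
      simpa using d.1.injective (Fin.ext h))
    (fun i => if h : i < s / 2 then (d.2 ⟨i, h⟩).1 else true)
    (fun i => if h : i < s / 2 then ((d.2 ⟨i, h⟩).2 : ℕ) else 0))
  refine ⟨w, fun i => ?_⟩
  have := hw i i.2
  simpa only [dif_pos i.2] using this

/-- Each coset has exactly one representative window with entries `mirror s b r + s k`, `0 ≤ k < n`.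
The residue modulo `s` recovers the letter `r` and the sign `b`; the residue modulo `n s` then
recovers `k`. -/
theorem index_congruenceSubgroup {s : ℕ} (hs : 2 ≤ s) {n : ℕ} (hn : 0 < n) :
    (congruenceSubgroup hs n).index = (2 * n) ^ (s / 2) * (s / 2).factorial := by
  have hs' : (0 : ℤ) < s := by omega
  choose F hF using fun d : WindowData (s / 2) n => exists_affineHyp_of_data hs d
  have hFmod : ∀ (d : WindowData (s / 2) n) (i : Fin (s / 2)),
      ((F d).1 : Equiv.Perm ℤ) (i : ℕ) ≡ mirror s (d.2 i).1 (d.1 i : ℕ)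
      [ZMOD s] := fun d i => by
    rw [hF]
    simp [Int.ModEq]
  have hbij : Function.Bijective
      fun d : WindowData (s / 2) n => (F d : AffineHyp hs ⧸ congruenceSubgroup hs n) := by
    constructor
    · intro d e h
      rw [QuotientGroup.eq, inv_mul_mem_congruenceSubgroup] at h
      have key : ∀ i, d.1 i = e.1 i ∧ d.2 i = e.2 i := by
        intro i
        have h1 := h i i.2
        have h2 : ((F d).1 : Equiv.Perm ℤ) (i : ℕ) ≡ ((F e).1 : Equiv.Perm ℤ) (i : ℕ) [ZMOD s] :=
          h1.of_dvd (Dvd.intro_left _ rfl)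
        have h3 := eq_of_modEq_of_mem (mirror_mem (d.1 i).2 _) (mirror_mem (e.1 i).2 _)
          ((hFmod d i).symm.trans (h2.trans (hFmod e i)))
        obtain ⟨h4, h5⟩ := mirror_inj (d.1 i).2 (e.1 i).2 h3
        rw [hF, hF, h3, mul_comm (n : ℤ)] at h1
        have h6 := Int.ModEq.mul_left_cancel' hs'.ne' (Int.ModEq.add_left_cancel' _ h1)
        have h7 := eq_of_modEq_of_mem (by omega) (by omega) h6
        exact ⟨Fin.ext h5, Prod.ext h4 (Fin.ext (by exact_mod_cast h7))⟩
      exact Prod.ext (Equiv.ext fun i => (key i).1) (funext fun i => (key i).2)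
    · intro q
      obtain ⟨w, rfl⟩ := QuotientGroup.mk_surjective q
      have hw := AffineHyp.isWindow w
      choose r b hrb using fun i : Fin (s / 2) =>
        exists_mirror (s := s) (by omega) (hw i i.2 i i.2).2
      -- Equal letters with equal signs would make two entries congruent modulo `s`; with opposite
      -- signs, one entry would be congruent to the mirror image of the other. A window allows
      -- neither.
      have hrinj : Function.Injective r := by
        intro i j hij
        by_contra hne
        have hne' : (i : ℕ) ≠ j := fun h => hne (Fin.ext h)
        by_cases hb : b i = b j
        · refine (hw i i.2 j j.2).1 hne' ?_
          change _ % _ = _ % _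
          rw [hrb, hrb, hij, hb]
        · refine (hw i i.2 j j.2).2 ?_
          have h1 := hrb i
          have h2 := hrb j
          have h3 : mirror s (b i) (r i : ℕ) = s - 1 - mirror s (b j) (r j : ℕ) := by
            rw [hij]
            revert hb
            cases b i <;> cases b j <;> simp [mirror]
          have h4 := Int.emod_add_mul_ediv ((w.1 : Equiv.Perm ℤ) (i : ℕ)) s
          have h5 := Int.emod_add_mul_ediv ((w.1 : Equiv.Perm ℤ) (j : ℕ)) s
          rw [Int.modEq_iff_dvd]
          refine ⟨-1 - ((w.1 : Equiv.Perm ℤ) (i : ℕ)) / s - ((w.1 : Equiv.Perm ℤ) (j : ℕ)) / s, ?_⟩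
          linear_combination h4 + h5 - h1 - h2 - h3
      have hn' : (0 : ℤ) < n := by exact_mod_cast hn
      have hk : ∀ x : ℤ, (x % n).toNat < n := fun x => by
        have := Int.emod_nonneg x hn'.ne'
        have := Int.emod_lt_of_pos x hn'
        omega
      refine ⟨⟨Equiv.ofBijective r (Finite.injective_iff_bijective.1 hrinj),
        fun i => (b i, ⟨_, hk ((w.1 : Equiv.Perm ℤ) (i : ℕ) / s)⟩)⟩, ?_⟩
      rw [QuotientGroup.eq, inv_mul_mem_congruenceSubgroup]
      intro i hi
      have h1 := hF ⟨Equiv.ofBijective r (Finite.injective_iff_bijective.1 hrinj),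
        fun i => (b i, ⟨_, hk ((w.1 : Equiv.Perm ℤ) (i : ℕ) / s)⟩)⟩ ⟨i, hi⟩
      simp only [Equiv.ofBijective_apply] at h1
      rw [h1, ← hrb ⟨i, hi⟩, Int.toNat_of_nonneg (Int.emod_nonneg _ hn'.ne')]
      simp only
      have h4 := Int.emod_add_mul_ediv ((w.1 : Equiv.Perm ℤ) (i : ℕ)) s
      have h5 := Int.emod_add_mul_ediv ((w.1 : Equiv.Perm ℤ) (i : ℕ) / s) n
      rw [Int.modEq_iff_dvd]
      refine ⟨(w.1 : Equiv.Perm ℤ) (i : ℕ) / s / n, ?_⟩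
      linear_combination -h4 - s * h5
  rw [Subgroup.index, ← Nat.card_eq_of_bijective _ hbij]
  simp only [Nat.card_eq_fintype_card, Fintype.card_prod, Fintype.card_perm, Fintype.card_fin,
    Fintype.card_pi, Fintype.card_bool, Finset.prod_const, Finset.card_univ]
  ring

/-! ### Stabilisers and orbits -/

theorem exists_levelIdx_modEq {s t : ℕ} (hst : s.Coprime t) (w : AffineSymm s) (a : ℤ) :
    ∃ i : ℤ, i * t ≡ a + levelShift s t [ZMOD s] ∧
      levelHom hst w a = a + t * ((w : Equiv.Perm ℤ) i - i) :=
  ⟨_, levelIdx_spec hst a, levelHom_apply hst w (levelIdx_spec hst a)⟩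

/-- An element congruent to the identity modulo `n s` acts, at level `t`, as a map congruent to the
identity modulo `n t s`. -/
theorem levelHom_modEq_of_mem {s t n : ℕ} {hs : 2 ≤ s} (hst : s.Coprime t) {w : AffineHyp hs}
    (hw : w ∈ congruenceSubgroup hs n) (a : ℤ) :
    levelHom hst w.1 a ≡ a [ZMOD (((n * t : ℕ) : ℤ) * s)] := by
  obtain ⟨i, -, h⟩ := exists_levelIdx_modEq hst w.1 a
  obtain ⟨k, hk⟩ := (hw i).dvd
  rw [h, Int.modEq_iff_dvd]
  refine ⟨k, ?_⟩
  push_cast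
  linear_combination t * hk

theorem coreEquiv_levelSMul_of_mem {s t n : ℕ} {hs : 2 ≤ s} (hst : s.Coprime t)
    {w : AffineHyp hs} (hw : w ∈ congruenceSubgroup hs n) (lam : SelfConjCore s) :
    CoreEquiv s (n * t) (levelSMul hs hst w lam).1 lam.1 := by
  have hs0 : 0 < s := by omega
  rw [SelfConjCore.coreEquiv_iff hs0]
  intro a ha b hb hab
  obtain ⟨a, rfl⟩ := (levelHom hst w.1).surjective a
  rw [sSet_levelSMul] at ha
  have h := levelHom_modEq_of_mem hst hw a
  have : a = b := lam.sSet_unique hs0 ha hb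
    ((h.of_dvd (Dvd.intro_left _ rfl)).symm.trans hab)
  rwa [← this]

/-- A core is fixed by no nontrivial element congruent to the identity modulo `s`. -/
theorem eq_one_of_levelSMul_eq {s t n : ℕ} {hs : 2 ≤ s} (hst : s.Coprime t) (ht : 0 < t)
    {w : AffineHyp hs} (hw : w ∈ congruenceSubgroup hs n) {lam : SelfConjCore s}
    (h : levelSMul hs hst w lam = lam) : w = 1 := by
  have hs0 : 0 < s := by omega
  refine AffineHyp.ext_half fun i _ => ?_
  -- The element of the `s`-set whose level index is `i`: the action moves it by `t * (w i - i)`, so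
  -- fixing it forces `w i = i`.
  obtain ⟨a, ha, hia⟩ := lam.exists_sSet hs0 ((i : ℤ) * t - levelShift s t)
  have hi : (i : ℤ) * t ≡ a + levelShift s t [ZMOD s] := by
    have := hia.add_right (levelShift s t)
    rwa [sub_add_cancel] at this
  have h1 := levelHom_apply hst w.1 hi
  have h2 := (sSet_levelSMul hs hst w lam a).2 ha
  rw [h] at h2
  have h3 := lam.sSet_unique hs0 h2 ha
    ((levelHom_modEq_of_mem hst hw a).of_dvd (Dvd.intro_left _ rfl))
  rw [h3] at h1
  have h4 : (t : ℤ) * ((w.1 : Equiv.Perm ℤ) i - i) = 0 := by linarith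
  have h5 := (mul_eq_zero.1 h4).resolve_left (by omega)
  change (w.1 : Equiv.Perm ℤ) i = i
  linarith

/-- Two equivalent cores are related by an element congruent to the identity modulo `n s`. -/
theorem exists_levelSMul_eq {s t n : ℕ} (hs : 2 ≤ s) (hst : s.Coprime t) (hnt : 0 < n * t)
    {lam mu : SelfConjCore s} (h : CoreEquiv s (n * t) lam.1 mu.1) :
    ∃ w ∈ congruenceSubgroup hs n, levelSMul hs hst w lam = mu := by
  have hs0 : 0 < s := by omega
  rw [SelfConjCore.coreEquiv_iff hs0] at h
  choose a ha hia using fun i : ℤ => lam.exists_sSet hs0 (i * t - levelShift s t)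
  choose b hb hib using fun i : ℤ => mu.exists_sSet hs0 (i * t - levelShift s t)
  have hab : ∀ i, a i ≡ b i [ZMOD (((n * t : ℕ) : ℤ) * s)] := fun i =>
    h _ (ha i) _ (hb i) ((hia i).symm.trans (hib i))
  -- The displacement from `a i` to `b i` is `n t s * k i`. The element sought is `m ↦ m + n s * k
  -- m`, whose level `t` action moves `a i` by exactly this amount.
  choose k hk using fun i => (hab i).dvd
  have hper : ∀ (c : ℤ → ℤ) (nu : SelfConjCore s), (∀ i, c i ∈ sSet s nu.1) →
      (∀ i, i * t - levelShift s t ≡ c i [ZMOD s]) →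
      ∀ i, c (i + s) = c i ∧ c (-1 - i) = s - 1 - c i := by
    intro c nu hc hic i
    constructor
    · refine nu.sSet_unique hs0 (hc _) (hc _) ((hic _).symm.trans (Int.ModEq.trans ?_ (hic i)))
      rw [Int.modEq_iff_dvd]
      exact ⟨-t, by ring⟩
    · refine nu.sSet_unique hs0 (hc _) (nu.sSet_symm hs0 (hc i)) ((hic _).symm.trans ?_)
      refine Int.ModEq.trans ?_ ((Int.ModEq.refl ((s : ℤ) - 1)).sub (hic i))
      -- The shift `½ (s - 1) (t - 1)` is what matches the two reflections: since its double is `(s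
      -- - 1) (t - 1)`, the two sides differ by exactly `s t`.
      have h2 := two_mul_levelShift hst
      rw [Int.modEq_iff_dvd]
      exact ⟨t, by linear_combination h2⟩
  have hnts : ((n * t : ℕ) : ℤ) * s ≠ 0 := mul_ne_zero (by exact_mod_cast hnt.ne') (by omega)
  have hk1 : ∀ i, k (i + s) = k i := fun i => by
    apply mul_left_cancel₀ hnts
    rw [← hk, ← hk, (hper a lam ha hia i).1, (hper b mu hb hib i).1]
  -- Self-conjugacy makes the displacement odd, which is what places the translation in the
  -- hyperoctahedral group and not merely in the affine symmetric group.
  have hk2 : ∀ i, k (-1 - i) = -k i := fun i => by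
    apply mul_left_cancel₀ hnts
    rw [← hk, mul_neg, ← hk, (hper a lam ha hia i).2, (hper b mu hb hib i).2]
    ring
  have hwin : IsWindow s fun i => (i : ℤ) + n * s * k i := by
    have h1 := AffineHyp.isWindow (1 : AffineHyp hs)
    have hmod : ∀ i : ℕ, (i : ℤ) + n * s * k i ≡ i [ZMOD s] := fun i => by
      rw [Int.modEq_iff_dvd]
      exact ⟨-(n * k i), by ring⟩
    intro i hi j hj
    obtain ⟨h2, h3⟩ := h1 i hi j hj
    exact ⟨fun hij h => h2 hij ((hmod i).symm.trans (h.trans (hmod j))),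
      fun h => h3 ((hmod i).symm.trans (h.trans ((Int.ModEq.refl (-1)).sub (hmod j))))⟩
  obtain ⟨w, hw⟩ := exists_affineHyp hs _ hwin
  have hw' : ∀ m, (w.1 : Equiv.Perm ℤ) m = m + n * s * k m :=
    eq_of_eq_on_half (w := fun m => m + n * s * k m) hs (AffineSymm.periodic w.1)
      (fun m => by rw [hk1]; ring) (AffineHyp.symm w) (fun m => by rw [hk2]; ring) hw
  refine ⟨w, fun m => ?_, ?_⟩
  · rw [hw', Int.modEq_iff_dvd]
    exact ⟨-k m, by ring⟩
  · refine SelfConjCore.eq_of_sSet_subset hs0 fun c hc => ?_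
    obtain ⟨c, rfl⟩ := (levelHom hst w.1).surjective c
    rw [sSet_levelSMul] at hc
    obtain ⟨i, hi, hic⟩ := exists_levelIdx_modEq hst w.1 c
    have hci : c = a i := by
      refine lam.sSet_unique hs0 hc (ha i) (Int.ModEq.trans ?_ (hia i))
      have := hi.sub_right (levelShift s t)
      rwa [add_sub_cancel_right, Int.modEq_comm] at this
    have : levelHom hst w.1 c = b i := by
      have hk' := hk i
      push_cast at hk'
      rw [hic, hw', hci]
      linear_combination -hk'
    rw [this]
    exact hb i

/-! ### Comparison of the two stabilisers and the orbit count -/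

/-- The stabiliser of a core of bounded spread under the level `t` action of the affine
hyperoctahedral group on cores of bounded spread. -/
noncomputable def boundedStab {s t : ℕ} (hs : 2 ≤ s) (hst : s.Coprime t) {N : ℕ} (hN : 0 < N)
    (lam : BoundedSelfConjCore s N) : Subgroup (AffineHyp hs) :=
  letI := boundedLevelAction hs hst hN
  MulAction.stabilizer (AffineHyp hs) lam

theorem mem_stabSC {s t : ℕ} {hs : 2 ≤ s} {hst : s.Coprime t} {lam : SelfConjCore s}
    {w : AffineHyp hs} : w ∈ stabSC hs hst lam ↔ levelSMul hs hst w lam = lam :=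
  Iff.rfl

theorem mem_boundedStab {s t : ℕ} {hs : 2 ≤ s} {hst : s.Coprime t} {N : ℕ} {hN : 0 < N}
    {lam : BoundedSelfConjCore s N} {w : AffineHyp hs} :
    w ∈ boundedStab hs hst hN lam ↔ CoreEquiv s N (levelSMul hs hst w lam.1).1 lam.1.1 := by
  constructor
  · intro h
    have h' : boundedLevelSMul hs hst hN w lam = lam := h
    have := coreEquiv_boundedLevelSMul hs hst hN w lam
    rwa [h'] at this
  · exact eq_boundedLevelSMul hs hst hN w lam lam

/-- If `w` fixes the core up to `≡_{nt}`, then some `v` in the congruence subgroup carries the image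
back to the core itself, and `w = v⁻¹ (v w)` with `v w` in `stabSC`. -/
theorem boundedStab_eq_sup {s t n : ℕ} (hs : 2 ≤ s) (hst : s.Coprime t) (hnt : 0 < n * t)
    (lam : BoundedSelfConjCore s (n * t)) :
    boundedStab hs hst hnt lam = stabSC hs hst lam.1 ⊔ congruenceSubgroup hs n := by
  apply le_antisymm
  · intro w hw
    obtain ⟨v, hv, h⟩ := exists_levelSMul_eq hs hst hnt (mem_boundedStab.1 hw)
    rw [← mul_levelSMul] at h
    have : w = v⁻¹ * (v * w) := by group
    rw [this]
    exact mul_mem (inv_mem (Subgroup.mem_sup_right hv)) (Subgroup.mem_sup_left h)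
  · refine sup_le (fun w hw => ?_) fun w hw => ?_
    · rw [mem_boundedStab, mem_stabSC.1 hw]
      exact ⟨Equiv.refl _, fun _ => Int.ModEq.refl _⟩
    · exact mem_boundedStab.2 (coreEquiv_levelSMul_of_mem hst hw lam.1)

/-- By the second isomorphism theorem, the index of the congruence subgroup in its product with
`stabSC` is the index of their trivial intersection in `stabSC`, that is, the order of `stabSC`. -/
theorem card_stabSC_mul_index {s t n : ℕ} (hs : 2 ≤ s) (hst : s.Coprime t) (hnt : 0 < n * t)
    (lam : BoundedSelfConjCore s (n * t)) :
    Nat.card (stabSC hs hst lam.1) * (boundedStab hs hst hnt lam).index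
      = (2 * n) ^ (s / 2) * (s / 2).factorial := by
  rw [← index_congruenceSubgroup hs (Nat.pos_of_mul_pos_right hnt),
    ← Subgroup.relIndex_mul_index (show congruenceSubgroup hs n ≤ boundedStab hs hst hnt lam by
      rw [boundedStab_eq_sup]; exact le_sup_right)]
  congr 1
  have hbot : congruenceSubgroup hs n ⊓ stabSC hs hst lam.1 = ⊥ :=
    (Subgroup.eq_bot_iff_forall _).2 fun w hw =>
      eq_one_of_levelSMul_eq hst (Nat.pos_of_mul_pos_left hnt) hw.1 hw.2
  rw [boundedStab_eq_sup, Subgroup.relIndex_sup_right, ← Subgroup.inf_relIndex_right, hbot,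
    Subgroup.relIndex_bot_left]

theorem card_levelOrbit {s t : ℕ} (hs : 2 ≤ s) (hst : s.Coprime t) {N : ℕ} (hN : 0 < N)
    (lam : BoundedSelfConjCore s N) :
    (levelOrbit hs hst hN lam).ncard = (boundedStab hs hst hN lam).index :=
  letI := boundedLevelAction hs hst hN
  (MulAction.index_stabilizer (AffineHyp hs) lam).symm

end SCCore

theorem mainTheorem6 (s t n : ℕ) (hs : 2 ≤ s) (hst : s.Coprime t) (hn : 1 ≤ n)
    (lam : SCCore.BoundedSelfConjCore s (n * t)) :
    Finite (SCCore.stabSC hs hst lam.1) ∧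
    (SCCore.levelOrbit hs hst (SCCore.mul_pos_of_coprime hs hst hn) lam).Finite ∧
    (Nat.card (SCCore.levelOrbit hs hst (SCCore.mul_pos_of_coprime hs hst hn) lam) : ℚ) =
      ((2 * n) ^ (s / 2) * (s / 2).factorial : ℚ) / Nat.card (SCCore.stabSC hs hst lam.1) := by
  have hnt := SCCore.mul_pos_of_coprime hs hst hn
  have h := SCCore.card_stabSC_mul_index hs hst hnt lam
  rw [← SCCore.card_levelOrbit] at h
  have hpos : 0 < (2 * n) ^ (s / 2) * (s / 2).factorial := by positivity
  rw [← h] at hpos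
  -- `Nat.card` and `Set.ncard` vanish on infinite sets, so the positive product yields both
  -- finiteness claims.
  have h1 := (Nat.pos_of_mul_pos_right hpos).ne'
  have h2 := (Nat.pos_of_mul_pos_left hpos).ne'
  refine ⟨Nat.finite_of_card_ne_zero h1, Set.finite_of_ncard_ne_zero h2, ?_⟩
  rw [Nat.card_coe_set_eq, eq_div_iff (by exact_mod_cast h1), mul_comm]
  exact_mod_cast h
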